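/- Let $n\ge 4$ be even, let $(M,h)$ be a smooth Riemannian manifold of dimension $n$, and let $g=r^{-2}(dr^2+h_r)$, $h_0=h$, be a Poincaré–Einstein metric on $(0,\varepsilon)\times M$ associated to $h$. That is: locally $h_r=a_r+r^n\log r\,b_r$ with $a,b$ of class $C^{n+1}$ up to $r=0$; in coordinates $(r,x)$, pointwise in $x$, the components of $Ric(g)+ng$ are $O(r^{n-2})$ as $r\to0$; and, as usual for even $n$, the components of $Ric(g)+ng$ involving $dr$ and the $h$-trace of its tangential part are $o(r^{n-2})$. For a metric of dimension $d$ with scalar curvature $\tau$ put ${\sf J}=\frac{\tau}{2(d-1)}$, ${\sf P}=\frac1{d-2}\big(Ric-{\sf J}\,g\big)$ (with $g$ the metric in question), $Q_2={\sf J}$, and let $P_2=\Delta-\big(\frac d2-1\big){\sf J}$ be the Yamabe operator, where $\Delta=\nabla^i\nabla_i$. Let $$P_4=\Delta^2+\delta\big((d-2){\sf J}-4{\sf P}\big)\#d+\Big(\frac d2-2\Big)\Big(\frac d2{\sf J}^2-2|{\sf P}|^2-\Delta{\sf J}\Big)$$ be the Paneitz operator ($\delta$ is the adjoint of $d$ on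 functions, i.e. minus the divergence, and $\#$ is the action of symmetric bilinear forms on 1-forms), and let $$Q_4=\frac d2{\sf J}^2-2|{\sf P}|^2-\Delta{\sf J}$$ be the fourth-order $Q$-curvature. Write $P_2,P_4,Q_2,Q_4$ for these objects for $h$ ($d=n$), and $\bar P_2,\bar Q_2$ for $P_2,Q_2$ of the metric $dr^2+h_r$ ($d=n+1$), so that $\bar P_2=\Delta_{dr^2+h_r}-\frac{n-1}2\bar Q_2$. Let $i^*$ denote restriction to $r=0$ (the limit as $r\to0^+$ at each point of $M$). Then $P_4(1)=\big(\frac n2-2\big)Q_4$, the boundary value $i^*\bar P_2(\bar Q_2)$ exists, and $$Q_4=P_2(Q_2)-2\,i^*\bar P_2(\bar Q_2)$$ on $M$; that is, $$P_2(Q_2)-2\,i^*\bar P_2(\bar Q_2)=\frac n2{\sf J}^2-2|{\sf P}|^2-\Delta{\sf J}.$$ -/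

import Mathlib

open scoped Manifold ContDiff Topology

namespace QCurv

/-! ### Riemannian geometry in local coordinates

A metric in local coordinates is a matrix valued function `g` on `ι → ℝ`; the dimension is
`Fintype.card ι`. -/

noncomputable section Coordinates

variable {ι : Type} [Fintype ι] [DecidableEq ι]

/-- The partial derivative `∂ f / ∂ x_i`. -/
def pd (i : ι) (f : (ι → ℝ) → ℝ) (x : ι → ℝ) : ℝ :=
  fderiv ℝ f x (Pi.single i 1)

/-- The Christoffel symbol `Γ^k_{ij}` of the Levi-Civita connection. -/
def christoffel (g : (ι → ℝ) → Matrix ι ι ℝ) (k i j : ι) (x : ι → ℝ) : ℝ :=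
  (1 / 2) * ∑ l, (g x)⁻¹ k l *
    (pd i (fun y => g y j l) x + pd j (fun y => g y i l) x - pd l (fun y => g y i j) x)

/-- The component `Ric_{ij}` of the Ricci tensor (positive on round spheres). -/
def ricci (g : (ι → ℝ) → Matrix ι ι ℝ) (i j : ι) (x : ι → ℝ) : ℝ :=
  ∑ k, (pd k (christoffel g k i j) x - pd j (christoffel g k i k) x
    + ∑ l, (christoffel g k k l x * christoffel g l i j x
      - christoffel g k j l x * christoffel g l i k x))

/-- The scalar curvature `τ`. -/
def scalarCurv (g : (ι → ℝ) → Matrix ι ι ℝ) (x : ι → ℝ) : ℝ :=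
  ∑ i, ∑ j, (g x)⁻¹ i j * ricci g i j x

/-- `J = τ / (2 (d - 1))` in dimension `d`. -/
def J (g : (ι → ℝ) → Matrix ι ι ℝ) (x : ι → ℝ) : ℝ :=
  scalarCurv g x / (2 * ((Fintype.card ι : ℝ) - 1))

/-- The component `P_{ij}` of the Schouten tensor
`P = (Ric - τ / (2 (d - 1)) g) / (d - 2)` in dimension `d`. -/
def schouten (g : (ι → ℝ) → Matrix ι ι ℝ) (i j : ι) (x : ι → ℝ) : ℝ :=
  (1 / ((Fintype.card ι : ℝ) - 2)) *
    (ricci g i j x - scalarCurv g x / (2 * ((Fintype.card ι : ℝ) - 1)) * g x i j)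

/-- `|P|^2`, the squared norm of the Schouten tensor. -/
def schoutenNormSq (g : (ι → ℝ) → Matrix ι ι ℝ) (x : ι → ℝ) : ℝ :=
  ∑ i, ∑ j, ∑ k, ∑ l,
    (g x)⁻¹ i k * (g x)⁻¹ j l * schouten g i j x * schouten g k l x

/-- The divergence `∇^i θ_i` of a 1-form. -/
def divergence (g : (ι → ℝ) → Matrix ι ι ℝ) (θ : ι → (ι → ℝ) → ℝ) (x : ι → ℝ) : ℝ :=
  ∑ i, ∑ j, (g x)⁻¹ i j * (pd i (θ j) x - ∑ k, christoffel g k i j x * θ k x)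

/-- The Laplacian `Δ u = ∇^i ∇_i u` (non-positive on closed manifolds). -/
def laplacian (g : (ι → ℝ) → Matrix ι ι ℝ) (u : (ι → ℝ) → ℝ) : (ι → ℝ) → ℝ :=
  divergence g (fun i => pd i u)

/-- The Yamabe operator `P_2 = Δ - (d/2 - 1) J` in dimension `d`. -/
def P2 (g : (ι → ℝ) → Matrix ι ι ℝ) (u : (ι → ℝ) → ℝ) (x : ι → ℝ) : ℝ :=
  laplacian g u x - ((Fintype.card ι : ℝ) / 2 - 1) * J g x * u x

/-- `Q_2 = J`. -/
def Q2 (g : (ι → ℝ) → Matrix ι ι ℝ) : (ι → ℝ) → ℝ := J g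

/-- `Q_4 = (d/2) J^2 - 2 |P|^2 - Δ J` in dimension `d`. -/
def Q4 (g : (ι → ℝ) → Matrix ι ι ℝ) (x : ι → ℝ) : ℝ :=
  (Fintype.card ι : ℝ) / 2 * J g x ^ 2 - 2 * schoutenNormSq g x - laplacian g (J g) x

/-- The Paneitz operator
`P_4 = Δ^2 + δ ((d - 2) J g - 4 P) # d + (d/2 - 2) ((d/2) J^2 - 2 |P|^2 - Δ J)`
in dimension `d`. Here `δ`, the adjoint of the exterior derivative, is minus the divergence, and
`(T # θ)_i = T_{ij} g^{jk} θ_k`. -/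
def P4 (g : (ι → ℝ) → Matrix ι ι ℝ) (u : (ι → ℝ) → ℝ) (x : ι → ℝ) : ℝ :=
  laplacian g (laplacian g u) x
    - divergence g (fun i y => ∑ j, ∑ k,
        (((Fintype.card ι : ℝ) - 2) * J g y * g y i j - 4 * schouten g i j y)
          * (g y)⁻¹ j k * pd k u y) x
    + ((Fintype.card ι : ℝ) / 2 - 2)
      * ((Fintype.card ι : ℝ) / 2 * J g x ^ 2 - 2 * schoutenNormSq g x - laplacian g (J g) x)
      * u x

end Coordinates

/-! ### The metrics `dr^2 + h_r` and `r^{-2} (dr^2 + h_r)` in local coordinates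

Coordinates on `(0, ε) × M` are indexed by `Fin (n + 1)`; the coordinate with index `0` is `r`. -/

noncomputable section Cylinder

variable {n : ℕ}

/-- The metric `dr^2 + h_r`. -/
def cylMetric (h : ℝ → (Fin n → ℝ) → Matrix (Fin n) (Fin n) ℝ)
    (p : Fin (n + 1) → ℝ) : Matrix (Fin (n + 1)) (Fin (n + 1)) ℝ :=
  Matrix.of (Fin.cons (Fin.cons 1 (fun _ => 0))
    (fun i => Fin.cons 0 (fun j => h (p 0) (Fin.tail p) i j)))

/-- The metric `g = r^{-2} (dr^2 + h_r)`. -/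
def poincareMetric (h : ℝ → (Fin n → ℝ) → Matrix (Fin n) (Fin n) ℝ)
    (p : Fin (n + 1) → ℝ) : Matrix (Fin (n + 1)) (Fin (n + 1)) ℝ :=
  ((p 0) ^ 2)⁻¹ • cylMetric h p

/-- The components at the point `(r, x)` of `Ric(g) + n g` for `g = r^{-2} (dr^2 + h_r)`. -/
def einsteinDefect (h : ℝ → (Fin n → ℝ) → Matrix (Fin n) (Fin n) ℝ)
    (r : ℝ) (x : Fin n → ℝ) (a b : Fin (n + 1)) : ℝ :=
  ricci (poincareMetric h) a b (Fin.cons r x) + (n : ℝ) * poincareMetric h (Fin.cons r x) a b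

end Cylinder

/-! ### Manifolds -/

noncomputable section Manifolds

variable {n : ℕ} {M : Type*} [TopologicalSpace M] [ChartedSpace (EuclideanSpace ℝ (Fin n)) M]
  [IsManifold (𝓡 n) ∞ M]

variable (n M) in
/-- Smooth Riemannian metrics on `M`. -/
abbrev Metric : Type _ :=
  Bundle.ContMDiffRiemannianMetric (𝓡 n) ∞ (EuclideanSpace ℝ (Fin n))
    (fun x : M => TangentSpace (𝓡 n) x)

/-- The domain in `Fin n → ℝ` of the coordinates of a chart. -/
def coordDomain (e : OpenPartialHomeomorph M (EuclideanSpace ℝ (Fin n))) : Set (Fin n → ℝ) :=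
  {x | WithLp.toLp 2 x ∈ e.target}

/-- The `i`-th coordinate vector field of the chart `e`, at the point with coordinates `x`. -/
def coordVector (e : OpenPartialHomeomorph M (EuclideanSpace ℝ (Fin n))) (x : Fin n → ℝ)
    (i : Fin n) : TangentSpace (𝓡 n) (e.symm (WithLp.toLp 2 x)) :=
  mfderiv (𝓡 n) (𝓡 n) e.symm (WithLp.toLp 2 x) (EuclideanSpace.single i (1 : ℝ))

/-- The matrix `h_{ij} = h(∂_i, ∂_j)` of the metric `h` in the chart `e`. -/
def coordMetric (h : Metric n M) (e : OpenPartialHomeomorph M (EuclideanSpace ℝ (Fin n)))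
    (x : Fin n → ℝ) : Matrix (Fin n) (Fin n) ℝ :=
  Matrix.of fun i j =>
    h.inner (e.symm (WithLp.toLp 2 x)) (coordVector e x i) (coordVector e x j)

/-- `g = r^{-2} (dr^2 + h_r)` on `(0, ε) × M` is a Poincaré-Einstein metric associated to `(M, h)`,
for the family of metrics `H r = h_r`, `0 ≤ r < ε`, on the manifold `M` of even dimension `n`.

The asymptotics `Ric(g) + n g = O(r^{n-2})` are asymptotics of the components in coordinates
`(r, x)`. As usual in even dimension `n`, they are supplemented by the condition that the
coefficient of `r^{n-2}` in `Ric(g) + n g` has no components involving `dr` and is trace-free with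
respect to `h`, which fixes the trace of the coefficient of `r^n` in `h_r`. -/
structure IsPoincareEinstein (h : Metric n M) (ε : ℝ) (H : ℝ → Metric n M) : Prop where
  /-- `ε` is positive. -/
  pos : 0 < ε
  /-- `h_0 = h`. -/
  initial : H 0 = h
  /-- Locally, `h_r = a_r + r^n log r b_r` with `a` and `b` of class `C^{n+1}` up to `r = 0`. -/
  expansion : ∀ e ∈ IsManifold.maximalAtlas (𝓡 n) ∞ M,
    ∃ a b : Fin n → Fin n → ℝ × (Fin n → ℝ) → ℝ,
      (∀ i j, ContDiffOn ℝ ((n + 1 : ℕ) : ℕ∞) (a i j) (Set.Ico 0 ε ×ˢ coordDomain e)) ∧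
      (∀ i j, ContDiffOn ℝ ((n + 1 : ℕ) : ℕ∞) (b i j) (Set.Ico 0 ε ×ˢ coordDomain e)) ∧
      ∀ r ∈ Set.Ico 0 ε, ∀ x ∈ coordDomain e, ∀ i j,
        coordMetric (H r) e x i j = a i j (r, x) + r ^ n * Real.log r * b i j (r, x)
  /-- `Ric(g) + n g = O(r^{n-2})`. -/
  einstein : ∀ e ∈ IsManifold.maximalAtlas (𝓡 n) ∞ M, ∀ x ∈ coordDomain e, ∀ a b,
    (fun r : ℝ => einsteinDefect (fun s => coordMetric (H s) e) r x a b)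
      =O[𝓝[>] 0] fun r : ℝ => r ^ (n - 2)
  /-- The components of `Ric(g) + n g` involving `dr` are `o(r^{n-2})`. -/
  normal : ∀ e ∈ IsManifold.maximalAtlas (𝓡 n) ∞ M, ∀ x ∈ coordDomain e, ∀ a,
    (fun r : ℝ => einsteinDefect (fun s => coordMetric (H s) e) r x 0 a)
      =o[𝓝[>] 0] fun r : ℝ => r ^ (n - 2)
  /-- The trace of the tangential part of `Ric(g) + n g` is `o(r^{n-2})`. -/
  trace : ∀ e ∈ IsManifold.maximalAtlas (𝓡 n) ∞ M, ∀ x ∈ coordDomain e,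
    (fun r : ℝ => ∑ i : Fin n, ∑ j : Fin n, (coordMetric h e x)⁻¹ i j *
        einsteinDefect (fun s => coordMetric (H s) e) r x i.succ j.succ)
      =o[𝓝[>] 0] fun r : ℝ => r ^ (n - 2)

/-- The metric `dr^2 + h_r` in the coordinates `(r, x)`, for coordinates `x` of the chart `e`. -/
def barMetric (H : ℝ → Metric n M) (e : OpenPartialHomeomorph M (EuclideanSpace ℝ (Fin n))) :
    (Fin (n + 1) → ℝ) → Matrix (Fin (n + 1)) (Fin (n + 1)) ℝ :=
  cylMetric fun s => coordMetric (H s) e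

/-- `i^* u = c` at the point with coordinates `x`: the function `u` of `(r, x)`, `r > 0`, has the
boundary value `c` there. -/
def HasBoundaryValue (u : (Fin (n + 1) → ℝ) → ℝ) (x : Fin n → ℝ) (c : ℝ) : Prop :=
  Filter.Tendsto (fun r : ℝ => u (Fin.cons r x)) (𝓝[>] 0) (𝓝 c)

end Manifolds

end QCurv

namespace QCurv

open Set Filter Asymptotics

/-! ### Powers times logarithms -/

/-! Write ' for ∂_r, L = tr(h_r⁻¹ h_r')/2, and J̄ for `J` of dr² + h_r. Two contractions of E =
Ric(g) + n g carry the proof. Its trace with respect to dr² + h_r is τ̄ + 2n L/r, so J̄ = -L/r +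
o(r²). Its dr dr component says (L/r)' = -(|h_r'|²/4 + E_00)/r.

The limits at r = 0 of r E and then of E, on tangential components, force h_r' = -2 r P + o(r) and
L/r → -J (`tendsto_rDeriv_div`). Hence |h_r'|² = 4 r² |P|² + o(r²), and integrating (L/r)' gives J̄
= J + r² |P|²/2 + o(r²) (`tendsto_J_cylMetric_sub_div`). Since Δ̄ = ∂_r² + L ∂_r + Δ_{h_r}, the
boundary value of Δ̄ J̄ is |P|² + ΔJ, and that of P̄_2(Q̄_2) is |P|² + ΔJ - (n-1)/2 J². The identity
for Q_4 is then arithmetic.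

The analytic difficulty is to differentiate the o(r²) expansion twice. In the worst case n = 4 the
metric has an r⁴ log r term, so J̄ = A + r² log r B with A, B of class C². The existence of a finite
quadratic coefficient forces B = 0 at r = 0, and this makes the second derivative converge
(`tendsto_derivs_of_log_expansion`). Working up to r = 0 requires derivatives within the half-open
collar, which agree with ordinary ones for r > 0. -/

theorem continuous_pow_succ_mul_log (k : ℕ) :
    Continuous fun r : ℝ => r ^ (k + 1) * Real.log r := by
  have : (fun r : ℝ => r ^ (k + 1) * Real.log r) = fun r => r ^ k * (r * Real.log r) := by
    funext r; ring
  rw [this]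
  exact (continuous_pow k).mul Real.continuous_mul_log

/-- At r = 0 the difference quotient is r^(k+1) log r, which tends to 0. Having one formula for all
real r makes the induction for higher regularity possible. -/
theorem hasDerivAt_pow_mul_log (k : ℕ) (r : ℝ) :
    HasDerivAt (fun r : ℝ => r ^ (k + 2) * Real.log r)
      ((k + 2 : ℕ) * (r ^ (k + 1) * Real.log r) + r ^ (k + 1)) r := by
  rcases eq_or_ne r 0 with rfl | hr
  · rw [hasDerivAt_iff_tendsto_slope]
    have h : Tendsto (fun r : ℝ => r ^ (k + 1) * Real.log r) (𝓝[≠] 0) (𝓝 0) := by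
      have := (continuous_pow_succ_mul_log k).tendsto 0
      simp only [ne_eq, Nat.add_eq_zero_iff, one_ne_zero, and_false, not_false_eq_true, zero_pow,
        zero_mul] at this
      exact this.mono_left nhdsWithin_le_nhds
    simp only [ne_eq, Nat.add_eq_zero_iff, one_ne_zero, and_false, not_false_eq_true, zero_pow,
        zero_mul, mul_zero, add_zero]
    refine h.congr' ?_
    filter_upwards [self_mem_nhdsWithin] with s hs
    have hs : s ≠ 0 := hs
    simp only [slope, vsub_eq_sub, sub_zero, ne_eq, Nat.add_eq_zero_iff, OfNat.ofNat_ne_zero,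
      and_false, not_false_eq_true, zero_pow, zero_mul, smul_eq_mul]
    field_simp
    ring
  · have := (hasDerivAt_pow (k + 2) r).mul (Real.hasDerivAt_log hr)
    refine this.congr_deriv ?_
    rw [show k + 2 - 1 = k + 1 from rfl]
    field_simp
    ring

theorem contDiff_pow_succ_mul_log (k : ℕ) :
    ContDiff ℝ k fun r : ℝ => r ^ (k + 1) * Real.log r := by
  induction k with
  | zero => simpa using Real.continuous_mul_log
  | succ k ih =>
    have hd := hasDerivAt_pow_mul_log k
    push_cast
    rw [contDiff_succ_iff_deriv]
    refine ⟨fun r => (hd r).differentiableAt, by simp, ?_⟩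
    have : deriv (fun r : ℝ => r ^ (k + 1 + 1) * Real.log r) = fun r =>
        ((k + 2 : ℕ) : ℝ) * (r ^ (k + 1) * Real.log r) + r ^ (k + 1) :=
      funext fun r => (hd r).deriv
    rw [this]
    fun_prop

/-! ### Partial derivatives within a set -/

section Within

set_option linter.unusedSectionVars false

variable {ι : Type} [Fintype ι] [DecidableEq ι]

/-- The partial derivative `∂ f / ∂ x_i` within a set `S`. -/
noncomputable def pdWithin (S : Set (ι → ℝ)) (i : ι) (f : (ι → ℝ) → ℝ) (x : ι → ℝ) : ℝ :=
  fderivWithin ℝ f S x (Pi.single i 1)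

variable {S : Set (ι → ℝ)} {f g : (ι → ℝ) → ℝ} {x : ι → ℝ} {i : ι}

theorem pdWithin_of_mem_nhds (h : S ∈ 𝓝 x) : pdWithin S i f x = pd i f x := by
  rw [pdWithin, pd, fderivWithin_of_mem_nhds h]

theorem pdWithin_congr (hfg : ∀ y ∈ S, f y = g y) (hx : x ∈ S) :
    pdWithin S i f x = pdWithin S i g x := by
  rw [pdWithin, pdWithin, fderivWithin_congr hfg (hfg x hx)]

theorem pd_congr (h : f =ᶠ[𝓝 x] g) : pd i f x = pd i g x := by
  rw [pd, pd, h.fderiv_eq]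

theorem contDiffOn_pdWithin (hS : UniqueDiffOn ℝ S) {m : ℕ} (hf : ContDiffOn ℝ (m + 1 : ℕ) f S) :
    ContDiffOn ℝ m (pdWithin S i f) S :=
  (hf.fderivWithin hS (by norm_cast)).clm_apply contDiffOn_const

theorem pdWithin_add (hS : UniqueDiffOn ℝ S) (hx : x ∈ S) (hf : DifferentiableWithinAt ℝ f S x)
    (hg : DifferentiableWithinAt ℝ g S x) :
    pdWithin S i (fun y => f y + g y) x = pdWithin S i f x + pdWithin S i g x := by
  simp only [pdWithin]
  rw [fderivWithin_fun_add (hS x hx) hf hg]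
  rfl

theorem pdWithin_mul (hS : UniqueDiffOn ℝ S) (hx : x ∈ S) (hf : DifferentiableWithinAt ℝ f S x)
    (hg : DifferentiableWithinAt ℝ g S x) :
    pdWithin S i (fun y => f y * g y) x = f x * pdWithin S i g x + g x * pdWithin S i f x := by
  simp only [pdWithin]
  rw [fderivWithin_fun_mul (hS x hx) hf hg]
  rfl

theorem pd_add (hf : DifferentiableAt ℝ f x) (hg : DifferentiableAt ℝ g x) :
    pd i (fun y => f y + g y) x = pd i f x + pd i g x := by
  simp only [pd]
  rw [fderiv_fun_add hf hg]
  rfl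

theorem pd_mul (hf : DifferentiableAt ℝ f x) (hg : DifferentiableAt ℝ g x) :
    pd i (fun y => f y * g y) x = f x * pd i g x + g x * pd i f x := by
  simp only [pd]
  rw [fderiv_fun_mul hf hg]
  rfl

theorem pd_sum {κ : Type*} (s : Finset κ)
    {F : κ → (ι → ℝ) → ℝ} (hF : ∀ k ∈ s, DifferentiableAt ℝ (F k) x) :
    pd i (fun y => ∑ k ∈ s, F k y) x = ∑ k ∈ s, pd i (F k) x := by
  simp only [pd]
  rw [fderiv_fun_sum hF]
  simp

theorem pd_const_mul (c : ℝ) (f : (ι → ℝ) → ℝ) (x : ι → ℝ) :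
    pd i (fun y => c * f y) x = c * pd i f x := by
  have h : (fun y => c * f y) = c • f := rfl
  rw [pd, h, fderiv_const_smul_field]
  rfl

@[simp]
theorem pd_const (c : ℝ) (x : ι → ℝ) : pd i (fun _ => c) x = 0 := by
  simp [pd]

theorem pd_comp_coord {j : ι} {u : ℝ → ℝ} {u' : ℝ} (hu : HasDerivAt u u' (x j)) :
    pd i (fun y : ι → ℝ => u (y j)) x = if i = j then u' else 0 := by
  have h := hu.hasFDerivAt.comp x (ContinuousLinearMap.proj (R := ℝ) (φ := fun _ : ι => ℝ) j).hasFDerivAt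
  have h' : HasFDerivAt (fun y : ι → ℝ => u (y j)) _ x := h
  rw [pd, h'.fderiv]
  simp [Pi.single_apply, eq_comm]

end Within

/-! ### Functions with a logarithmic term -/

section LogSum

variable {n : ℕ} {S : Set (Fin (n + 1) → ℝ)}

/-- `f = A + r^k log r B` on `S`, with `A` and `B` of class `C^j` on `S`. -/
def IsLogSum (S : Set (Fin (n + 1) → ℝ)) (k j : ℕ) (f : (Fin (n + 1) → ℝ) → ℝ) : Prop :=
  ∃ A B : (Fin (n + 1) → ℝ) → ℝ, ContDiffOn ℝ j A S ∧ ContDiffOn ℝ j B S ∧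
    ∀ p ∈ S, f p = A p + p 0 ^ k * Real.log (p 0) * B p

variable {k j : ℕ} {f g : (Fin (n + 1) → ℝ) → ℝ}

theorem IsLogSum.congr (hf : IsLogSum S k j f) (h : ∀ p ∈ S, g p = f p) : IsLogSum S k j g := by
  obtain ⟨A, B, hA, hB, hAB⟩ := hf
  exact ⟨A, B, hA, hB, fun p hp => (h p hp).trans (hAB p hp)⟩

theorem isLogSum_of_contDiffOn (hf : ContDiffOn ℝ j f S) : IsLogSum S k j f :=
  ⟨f, fun _ => 0, hf, contDiffOn_const, by simp⟩

theorem IsLogSum.add (hf : IsLogSum S k j f) (hg : IsLogSum S k j g) :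
    IsLogSum S k j fun p => f p + g p := by
  obtain ⟨A, B, hA, hB, hAB⟩ := hf
  obtain ⟨A', B', hA', hB', hAB'⟩ := hg
  refine ⟨_, _, hA.add hA', hB.add hB', fun p hp => ?_⟩
  simp only [hAB p hp, hAB' p hp]
  ring

theorem IsLogSum.mul_left (hf : IsLogSum S k j f) (hg : ContDiffOn ℝ j g S) :
    IsLogSum S k j fun p => g p * f p := by
  obtain ⟨A, B, hA, hB, hAB⟩ := hf
  refine ⟨_, _, hg.mul hA, hg.mul hB, fun p hp => ?_⟩
  simp only [hAB p hp]
  ring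

theorem IsLogSum.const_mul (hf : IsLogSum S k j f) (c : ℝ) :
    IsLogSum S k j fun p => c * f p :=
  hf.mul_left contDiffOn_const

theorem IsLogSum.sub (hf : IsLogSum S k j f) (hg : IsLogSum S k j g) :
    IsLogSum S k j fun p => f p - g p :=
  (hf.add (hg.const_mul (-1))).congr fun p _ => by ring

theorem IsLogSum.sum {κ : Type*} (s : Finset κ) {F : κ → (Fin (n + 1) → ℝ) → ℝ}
    (hF : ∀ a ∈ s, IsLogSum S k j (F a)) : IsLogSum S k j fun p => ∑ a ∈ s, F a p := by
  classical
  induction s using Finset.induction_on with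
  | empty => simpa using isLogSum_of_contDiffOn (contDiffOn_const (c := (0 : ℝ)))
  | insert a s ha ih =>
    have := (hF a (Finset.mem_insert_self a s)).add
      (ih fun b hb => hF b (Finset.mem_insert_of_mem hb))
    exact this.congr fun p _ => Finset.sum_insert ha

/-- Surplus powers of r are absorbed into the coefficient B of the logarithm. -/
theorem IsLogSum.mono {k' j' : ℕ} (hf : IsLogSum S k j f) (hk : k' ≤ k) (hj : j' ≤ j) :
    IsLogSum S k' j' f := by
  obtain ⟨A, B, hA, hB, hAB⟩ := hf
  have hj : (j' : WithTop ℕ∞) ≤ j := by exact_mod_cast hj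
  have hr : ContDiffOn ℝ j' (fun p : Fin (n + 1) → ℝ => p 0 ^ (k - k')) S := by fun_prop
  refine ⟨A, _, hA.of_le hj, hr.mul (hB.of_le hj), fun p hp => ?_⟩
  rw [hAB p hp]
  have : p 0 ^ k = p 0 ^ k' * p 0 ^ (k - k') := by rw [← pow_add]; congr 1; omega
  rw [this]
  ring

theorem IsLogSum.contDiffOn (hf : IsLogSum S (k + 1) j f) (hkj : j ≤ k) : ContDiffOn ℝ j f S := by
  obtain ⟨A, B, hA, hB, hAB⟩ := hf.mono (Nat.succ_le_succ hkj) le_rfl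
  have h : ContDiffOn ℝ j (fun p : Fin (n + 1) → ℝ => p 0 ^ (j + 1) * Real.log (p 0)) S :=
    ((contDiff_pow_succ_mul_log j).comp (contDiff_apply ℝ ℝ (0 : Fin (n + 1)))).contDiffOn
  exact (hA.add (h.mul hB)).congr hAB

/-- One derivative costs one power of r before the logarithm and one order of regularity of the
coefficients. -/
theorem IsLogSum.pdWithin (hS : UniqueDiffOn ℝ S) (hf : IsLogSum S (k + 2) (j + 1) f)
    (i : Fin (n + 1)) : IsLogSum S (k + 1) j (pdWithin S i f) := by
  obtain ⟨A, B, hA, hB, hAB⟩ := hf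
  let δ : ℝ := if i = 0 then 1 else 0
  have hr : ∀ m, ContDiffOn ℝ j (fun p : Fin (n + 1) → ℝ => p 0 ^ m) S := fun m => by fun_prop
  have hj : (j : WithTop ℕ∞) ≤ ((j + 1 : ℕ) : WithTop ℕ∞) := by exact_mod_cast Nat.le_succ j
  -- The log-free term r^(k+1) B produced by differentiating the logarithm joins A. The term with
  -- ∂_i B keeps one power of r too many, which becomes the factor `p 0 ^ 1`.
  refine ⟨fun p => QCurv.pdWithin S i A p + δ * (p 0 ^ (k + 1) * B p),
    fun p => p 0 ^ 1 * QCurv.pdWithin S i B p + (δ * (k + 2 : ℕ)) * B p,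
    (contDiffOn_pdWithin hS hA).add (contDiffOn_const.mul ((hr _).mul (hB.of_le hj))),
    ((hr _).mul (contDiffOn_pdWithin hS hB)).add (contDiffOn_const.mul (hB.of_le hj)),
    fun p hp => ?_⟩
  have hne : ((j + 1 : ℕ) : WithTop ℕ∞) ≠ 0 := by exact_mod_cast Nat.succ_ne_zero j
  have hAd := hA.differentiableOn hne p hp
  have hBd := hB.differentiableOn hne p hp
  have hl := ((hasDerivAt_pow_mul_log k (p 0)).hasFDerivAt.comp p
    (ContinuousLinearMap.proj (R := ℝ) (φ := fun _ : Fin (n + 1) => ℝ) 0).hasFDerivAt)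
  have hl' : HasFDerivAt (fun p : Fin (n + 1) → ℝ => p 0 ^ (k + 2) * Real.log (p 0)) _ p := hl
  rw [pdWithin_congr hAB hp, pdWithin_add hS hp hAd
    (hl'.differentiableAt.differentiableWithinAt.fun_mul hBd),
    pdWithin_mul hS hp hl'.differentiableAt.differentiableWithinAt hBd]
  have : QCurv.pdWithin S i (fun p : Fin (n + 1) → ℝ => p 0 ^ (k + 2) * Real.log (p 0)) p
      = δ * ((k + 2 : ℕ) * (p 0 ^ (k + 1) * Real.log (p 0)) + p 0 ^ (k + 1)) := by
    rw [QCurv.pdWithin, hl'.hasFDerivWithinAt.fderivWithin (hS p hp)]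
    simp only [ContinuousLinearMap.comp_apply, ContinuousLinearMap.proj_apply, δ, Pi.single_apply,
      eq_comm (a := (0 : Fin (n + 1)))]
    split_ifs <;> simp
  rw [this]
  ring

end LogSum

/-! ### Functions of one variable near an endpoint -/

section OneVariable

variable {ε : ℝ}

theorem Ioo_mem_nhdsGT_zero (hε : 0 < ε) : Ioo 0 ε ∈ 𝓝[>] (0 : ℝ) :=
  Ioo_mem_nhdsGT hε

theorem tendsto_id_nhdsGT_zero : Tendsto (fun r : ℝ => r) (𝓝[>] 0) (𝓝 0) :=
  tendsto_id.mono_left nhdsWithin_le_nhds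

theorem nhdsGT_zero_le_nhdsWithin_Ico (hε : 0 < ε) : 𝓝[>] (0 : ℝ) ≤ 𝓝[Ico 0 ε] 0 :=
  le_inf nhdsWithin_le_nhds
    (le_principal_iff.2 (mem_of_superset (Ioo_mem_nhdsGT_zero hε) Ioo_subset_Ico_self))

theorem tendsto_pow_succ_mul_log_zero (k : ℕ) :
    Tendsto (fun r : ℝ => r ^ (k + 1) * Real.log r) (𝓝[>] 0) (𝓝 0) := by
  have := (continuous_pow_succ_mul_log k).tendsto 0
  simp only [ne_eq, Nat.add_eq_zero_iff, one_ne_zero, and_false, not_false_eq_true, zero_pow,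
    zero_mul] at this
  exact this.mono_left nhdsWithin_le_nhds

theorem uniqueDiffOn_Ico_zero (ε : ℝ) : UniqueDiffOn ℝ (Ico 0 ε) := uniqueDiffOn_Ico 0 ε

theorem hasDerivAt_of_contDiffOn_Ico {A : ℝ → ℝ} {m : ℕ} (hA : ContDiffOn ℝ (m + 1 : ℕ) A (Ico 0 ε))
    {r : ℝ} (hr : r ∈ Ioo 0 ε) : HasDerivAt A (derivWithin A (Ico 0 ε) r) r := by
  have h := hA.differentiableOn (by exact_mod_cast Nat.succ_ne_zero m) r (Ioo_subset_Ico_self hr)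
  exact h.hasDerivWithinAt.hasDerivAt (Ico_mem_nhds hr.1 hr.2)

theorem contDiffOn_derivWithin_Ico {A : ℝ → ℝ} {m : ℕ}
    (hA : ContDiffOn ℝ (m + 1 : ℕ) A (Ico 0 ε)) :
    ContDiffOn ℝ m (derivWithin A (Ico 0 ε)) (Ico 0 ε) :=
  hA.derivWithin (uniqueDiffOn_Ico_zero ε) (by norm_cast)

theorem tendsto_of_contDiffOn_Ico (hε : 0 < ε) {A : ℝ → ℝ} {m : ℕ}
    (hA : ContDiffOn ℝ m A (Ico 0 ε)) : Tendsto A (𝓝[>] 0) (𝓝 (A 0)) :=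
  (hA.continuousOn 0 ⟨le_rfl, hε⟩).mono_left (nhdsGT_zero_le_nhdsWithin_Ico hε)

theorem tendsto_slope_of_contDiffOn_Ico (hε : 0 < ε) {A : ℝ → ℝ} {m : ℕ}
    (hA : ContDiffOn ℝ (m + 1 : ℕ) A (Ico 0 ε)) :
    Tendsto (fun r => (A r - A 0) / r) (𝓝[>] 0) (𝓝 (derivWithin A (Ico 0 ε) 0)) := by
  have h := (hA.differentiableOn (by exact_mod_cast Nat.succ_ne_zero m) 0
    ⟨le_rfl, hε⟩).hasDerivWithinAt.mono Ioo_subset_Ico_self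
  rw [hasDerivWithinAt_iff_tendsto_slope' (by simp)] at h
  have h' : Tendsto (slope A 0) (𝓝[>] 0) (𝓝 (derivWithin A (Ico 0 ε) 0)) :=
    h.mono_left (le_inf nhdsWithin_le_nhds (le_principal_iff.2 (Ioo_mem_nhdsGT_zero hε)))
  refine h'.congr fun r => ?_
  simp [slope, div_eq_inv_mul]

/-- A function with limit `α` at `0` whose derivative is `β r + o(r)` is `α + β r^2 / 2 + o(r^2)`. -/
theorem tendsto_sub_div_sq (hε : 0 < ε) {f f' : ℝ → ℝ} {α β : ℝ}
    (hf : ∀ r ∈ Ioo 0 ε, HasDerivAt f (f' r) r) (hα : Tendsto f (𝓝[>] 0) (𝓝 α))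
    (hβ : Tendsto (fun r => f' r / r) (𝓝[>] 0) (𝓝 β)) :
    Tendsto (fun r => (f r - α) / r ^ 2) (𝓝[>] 0) (𝓝 (β / 2)) := by
  refine HasDerivAt.lhopital_zero_right_on_Ioo (g' := fun r => 2 * r) hε
    (fun r hr => (hf r hr).sub_const α) (fun r _ => by simpa using hasDerivAt_pow 2 r)
    (fun r hr => mul_ne_zero two_ne_zero hr.1.ne') ?_ ?_ ?_
  · simpa using hα.sub_const α
  · simpa using tendsto_id_nhdsGT_zero.pow 2
  · refine (hβ.div_const 2).congr fun r => ?_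
    rw [div_div, mul_comm]

theorem tendsto_deriv_of_contDiffOn_Ico (hε : 0 < ε) {A : ℝ → ℝ} {m : ℕ}
    (hA : ContDiffOn ℝ (m + 1 : ℕ) A (Ico 0 ε)) :
    Tendsto (deriv A) (𝓝[>] 0) (𝓝 (derivWithin A (Ico 0 ε) 0)) := by
  refine (tendsto_of_contDiffOn_Ico hε (contDiffOn_derivWithin_Ico hA)).congr' ?_
  filter_upwards [Ioo_mem_nhdsGT_zero hε] with r hr
  exact (hasDerivAt_of_contDiffOn_Ico hA hr).deriv.symm

theorem deriv_deriv_eq_of_contDiffOn_Ico {A : ℝ → ℝ} {m : ℕ}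
    (hA : ContDiffOn ℝ (m + 1 : ℕ) A (Ico 0 ε)) {r : ℝ} (hr : r ∈ Ioo 0 ε) :
    deriv (deriv A) r = deriv (derivWithin A (Ico 0 ε)) r := by
  refine EventuallyEq.deriv_eq ?_
  filter_upwards [Ioo_mem_nhds hr.1 hr.2] with s hs
  exact (hasDerivAt_of_contDiffOn_Ico hA hs).deriv

theorem tendsto_deriv_deriv_of_contDiffOn_Ico (hε : 0 < ε) {A : ℝ → ℝ} {m : ℕ}
    (hA : ContDiffOn ℝ (m + 2 : ℕ) A (Ico 0 ε)) :
    Tendsto (deriv (deriv A)) (𝓝[>] 0)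
      (𝓝 (derivWithin (derivWithin A (Ico 0 ε)) (Ico 0 ε) 0)) := by
  refine (tendsto_deriv_of_contDiffOn_Ico hε
    (contDiffOn_derivWithin_Ico (m := m + 1) hA)).congr' ?_
  filter_upwards [Ioo_mem_nhdsGT_zero hε] with r hr
  exact (deriv_deriv_eq_of_contDiffOn_Ico (m := m + 1) hA hr).symm

theorem tendsto_deriv_div_of_contDiffOn_Ico (hε : 0 < ε) {A : ℝ → ℝ} {m : ℕ}
    (hA : ContDiffOn ℝ (m + 2 : ℕ) A (Ico 0 ε)) (h0 : derivWithin A (Ico 0 ε) 0 = 0) :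
    Tendsto (fun r => deriv A r / r) (𝓝[>] 0)
      (𝓝 (derivWithin (derivWithin A (Ico 0 ε)) (Ico 0 ε) 0)) := by
  refine (tendsto_slope_of_contDiffOn_Ico hε
    (contDiffOn_derivWithin_Ico (m := m + 1) hA)).congr' ?_
  filter_upwards [Ioo_mem_nhdsGT_zero hε] with r hr
  rw [h0, sub_zero, (hasDerivAt_of_contDiffOn_Ico (m := m + 1) hA hr).deriv]

/-- If `A + r^2 log r B`, with `A` and `B` of class `C^2` up to `0`, is `α + γ r^2 / 2 + o(r^2)`,
then this expansion may be differentiated twice. -/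
theorem tendsto_derivs_of_log_expansion (hε : 0 < ε) {A B f : ℝ → ℝ} {α γ : ℝ}
    (hA : ContDiffOn ℝ (2 : ℕ) A (Ico 0 ε)) (hB : ContDiffOn ℝ (2 : ℕ) B (Ico 0 ε))
    (hf : ∀ r ∈ Ioo 0 ε, f r = A r + r ^ 2 * Real.log r * B r)
    (hγ : Tendsto (fun r => (f r - α) / r ^ 2) (𝓝[>] 0) (𝓝 (γ / 2))) :
    Tendsto (deriv f) (𝓝[>] 0) (𝓝 0) ∧ Tendsto (deriv (deriv f)) (𝓝[>] 0) (𝓝 γ) := by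
  set I := Ico 0 ε
  set A1 := derivWithin A I
  set B1 := derivWithin B I
  set A2 := derivWithin A1 I
  set B2 := derivWithin B1 I
  have cA1 : ContDiffOn ℝ (1 : ℕ) A1 I := contDiffOn_derivWithin_Ico hA
  have cB1 : ContDiffOn ℝ (1 : ℕ) B1 I := contDiffOn_derivWithin_Ico hB
  have cA2 : ContDiffOn ℝ (0 : ℕ) A2 I := contDiffOn_derivWithin_Ico cA1
  have cB2 : ContDiffOn ℝ (0 : ℕ) B2 I := contDiffOn_derivWithin_Ico cB1
  have tA := tendsto_of_contDiffOn_Ico hε hA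
  have tB := tendsto_of_contDiffOn_Ico hε hB
  have tA1 := tendsto_of_contDiffOn_Ico hε cA1
  have tB1 := tendsto_of_contDiffOn_Ico hε cB1
  have tA2 := tendsto_of_contDiffOn_Ico hε cA2
  have tB2 := tendsto_of_contDiffOn_Ico hε cB2
  have sA : Tendsto (fun r => (A r - A 0) / r) (𝓝[>] 0) (𝓝 (A1 0)) :=
    tendsto_slope_of_contDiffOn_Ico (m := 1) hε hA
  have sA1 : Tendsto (fun r => (A1 r - A1 0) / r) (𝓝[>] 0) (𝓝 (A2 0)) :=
    tendsto_slope_of_contDiffOn_Ico (m := 0) hε cA1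
  have sB : Tendsto (fun r => (B r - B 0) / r) (𝓝[>] 0) (𝓝 (B1 0)) :=
    tendsto_slope_of_contDiffOn_Ico (m := 1) hε hB
  have l1 : Tendsto (fun r : ℝ => r * Real.log r) (𝓝[>] 0) (𝓝 0) := by
    simpa using tendsto_pow_succ_mul_log_zero 0
  have l2 : Tendsto (fun r : ℝ => r ^ 2 * Real.log r) (𝓝[>] 0) (𝓝 0) :=
    tendsto_pow_succ_mul_log_zero 1
  have hI := Ioo_mem_nhdsGT_zero hε
  -- Matching orders: the limits of f - α and of (f - α)/r fix the constant and linear Taylor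
  -- coefficients of A, as r² log r and r log r tend to 0.
  have hα : α = A 0 := by
    have h1 : Tendsto (fun r => f r - α) (𝓝[>] 0) (𝓝 0) := by
      have := hγ.mul (tendsto_id_nhdsGT_zero.pow 2)
      simp only [ne_eq, OfNat.ofNat_ne_zero, not_false_eq_true, zero_pow, mul_zero] at this
      refine this.congr' ?_
      filter_upwards [hI] with r hr
      have := hr.1.ne'
      field_simp
    have h2 : Tendsto (fun r => f r - α) (𝓝[>] 0) (𝓝 (A 0 + 0 * B 0 - α)) := by
      refine ((tA.add (l2.mul tB)).sub_const α).congr' ?_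
      filter_upwards [hI] with r hr
      rw [hf r hr]
    have := tendsto_nhds_unique h1 h2
    linarith
  have hA1 : A1 0 = 0 := by
    have h1 : Tendsto (fun r => (f r - α) / r) (𝓝[>] 0) (𝓝 0) := by
      have := hγ.mul tendsto_id_nhdsGT_zero
      simp only [mul_zero] at this
      refine this.congr' ?_
      filter_upwards [hI] with r hr
      have := hr.1.ne'
      field_simp
    have h2 : Tendsto (fun r => (f r - α) / r) (𝓝[>] 0) (𝓝 (A1 0 + 0 * B 0)) := by
      refine (sA.add (l1.mul tB)).congr' ?_
      filter_upwards [hI] with r hr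
      have := hr.1.ne'
      rw [hf r hr, hα]
      field_simp
      ring
    have := tendsto_nhds_unique h1 h2
    linarith
  have qA : Tendsto (fun r => (A r - A 0) / r ^ 2) (𝓝[>] 0) (𝓝 (A2 0 / 2)) := by
    refine tendsto_sub_div_sq hε (f' := A1)
      (fun r hr => hasDerivAt_of_contDiffOn_Ico (m := 1) hA hr) tA ?_
    simpa [hA1] using sA1
  -- Removing the quadratic Taylor polynomial of A isolates log r · B, which therefore has a finite
  -- limit. As log r → -∞, B must vanish at 0.
  have lB : Tendsto (fun r => Real.log r * B r) (𝓝[>] 0) (𝓝 (γ / 2 - A2 0 / 2)) := by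
    refine (hγ.sub qA).congr' ?_
    filter_upwards [hI] with r hr
    have := hr.1.ne'
    rw [hf r hr, hα]
    field_simp
    ring
  have hB0 : B 0 = 0 := by
    have h1 : Tendsto (fun r : ℝ => (Real.log r)⁻¹) (𝓝[>] 0) (𝓝 0) :=
      Real.tendsto_log_nhdsGT_zero.inv_tendsto_atBot
    have h2 := h1.mul lB
    rw [zero_mul] at h2
    refine tendsto_nhds_unique tB (h2.congr' ?_)
    filter_upwards [Real.tendsto_log_nhdsGT_zero.eventually_lt_atBot 0] with r hr
    rw [inv_mul_cancel_left₀ hr.ne]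
  -- With B 0 = 0, log r · B is (r log r) · (B/r) and tends to 0. Comparison with the previous limit
  -- gives A''(0) = γ, and the only dangerous term of f'' is under control.
  have lB0 : Tendsto (fun r => Real.log r * B r) (𝓝[>] 0) (𝓝 0) := by
    have := l1.mul sB
    rw [zero_mul] at this
    refine this.congr' ?_
    filter_upwards [hI] with r hr
    have := hr.1.ne'
    rw [hB0]
    field_simp
    ring
  have hA2 : A2 0 = γ := by
    have := tendsto_nhds_unique lB lB0
    linarith
  have d1 : ∀ r ∈ Ioo 0 ε, HasDerivAt f
      (A1 r + (r ^ 2 * Real.log r * B1 r + (2 * (r * Real.log r) + r) * B r)) r := by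
    intro r hr
    have h1 := (hasDerivAt_of_contDiffOn_Ico (m := 1) hA hr).add
      ((hasDerivAt_pow_mul_log 0 r).mul (hasDerivAt_of_contDiffOn_Ico (m := 1) hB hr))
    refine (h1.congr_of_eventuallyEq ?_).congr_deriv ?_
    · filter_upwards [Ioo_mem_nhds hr.1 hr.2] with s hs using hf s hs
    · simp only [A1, B1, I]
      push_cast
      ring
  have e1 : ∀ r ∈ Ioo 0 ε, deriv f r
      = A1 r + (r ^ 2 * Real.log r * B1 r + (2 * (r * Real.log r) + r) * B r) :=
    fun r hr => (d1 r hr).deriv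
  have e2 : ∀ r ∈ Ioo 0 ε, deriv (deriv f) r
      = A2 r + r ^ 2 * Real.log r * B2 r + 2 * (2 * (r * Real.log r) + r) * B1 r
        + (2 * (Real.log r * B r) + 3 * B r) := by
    intro r hr
    have hB := hasDerivAt_of_contDiffOn_Ico (m := 1) hB hr
    have hA1 := hasDerivAt_of_contDiffOn_Ico (m := 0) cA1 hr
    have hB1 := hasDerivAt_of_contDiffOn_Ico (m := 0) cB1 hr
    have hl := (hasDerivAt_id r).mul (Real.hasDerivAt_log hr.1.ne')
    have h1 := hA1.add (((hasDerivAt_pow_mul_log 0 r).mul hB1).add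
      (((hl.const_mul 2).add (hasDerivAt_id r)).mul hB))
    have h2 := h1.congr_of_eventuallyEq (f₁ := deriv f) (by
      filter_upwards [Ioo_mem_nhds hr.1 hr.2] with s hs using e1 s hs)
    rw [h2.deriv]
    have := hr.1.ne'
    simp only [A2, B2, B1, I, id, Pi.add_apply, Pi.mul_apply]
    push_cast
    field_simp
    ring
  constructor
  · have : Tendsto (fun r => A1 r + (r ^ 2 * Real.log r * B1 r + (2 * (r * Real.log r) + r) * B r))
        (𝓝[>] 0) (𝓝 (A1 0 + (0 * B1 0 + (2 * 0 + 0) * B 0))) :=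
      tA1.add ((l2.mul tB1).add (((l1.const_mul 2).add tendsto_id_nhdsGT_zero).mul tB))
    rw [hA1] at this
    simp only [zero_mul, mul_zero, add_zero] at this
    refine this.congr' ?_
    filter_upwards [hI] with r hr using (e1 r hr).symm
  · have : Tendsto (fun r => A2 r + r ^ 2 * Real.log r * B2 r
          + 2 * (2 * (r * Real.log r) + r) * B1 r + (2 * (Real.log r * B r) + 3 * B r))
        (𝓝[>] 0) (𝓝 (A2 0 + 0 * B2 0 + 2 * (2 * 0 + 0) * B1 0 + (2 * 0 + 3 * B 0))) :=
      ((tA2.add (l2.mul tB2)).add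
        ((((l1.const_mul 2).add tendsto_id_nhdsGT_zero).const_mul 2).mul tB1)).add
        ((lB0.const_mul 2).add (tB.const_mul 3))
    rw [hB0, hA2] at this
    simp only [zero_mul, mul_zero, add_zero] at this
    refine this.congr' ?_
    filter_upwards [hI] with r hr using (e2 r hr).symm

end OneVariable

/-! ### Collar neighbourhoods of the boundary in coordinates -/

section Collar

variable {n : ℕ} {ε : ℝ} {U : Set (Fin n → ℝ)}

/-- The points `(r, x)` with `0 ≤ r < ε` and `x ∈ U`. -/
def collar (ε : ℝ) (U : Set (Fin n → ℝ)) : Set (Fin (n + 1) → ℝ) :=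
  {p | p 0 ∈ Ico 0 ε ∧ Fin.tail p ∈ U}

/-- The points `(r, x)` with `0 < r < ε` and `x ∈ U`. -/
def openCollar (ε : ℝ) (U : Set (Fin n → ℝ)) : Set (Fin (n + 1) → ℝ) :=
  {p | p 0 ∈ Ioo 0 ε ∧ Fin.tail p ∈ U}

theorem openCollar_subset : openCollar ε U ⊆ collar ε U :=
  fun _ hp => ⟨Ioo_subset_Ico_self hp.1, hp.2⟩

theorem cons_mem_collar {r : ℝ} {x : Fin n → ℝ} (hr : r ∈ Ico 0 ε) (hx : x ∈ U) :
    (Fin.cons r x : Fin (n + 1) → ℝ) ∈ collar ε U :=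
  ⟨by simpa using hr, by simpa using hx⟩

theorem cons_mem_openCollar {r : ℝ} {x : Fin n → ℝ} (hr : r ∈ Ioo 0 ε) (hx : x ∈ U) :
    (Fin.cons r x : Fin (n + 1) → ℝ) ∈ openCollar ε U :=
  ⟨by simpa using hr, by simpa using hx⟩

theorem contDiff_tail {m : WithTop ℕ∞} :
    ContDiff ℝ m (Fin.tail : (Fin (n + 1) → ℝ) → Fin n → ℝ) :=
  contDiff_pi.2 fun i => contDiff_apply ℝ ℝ i.succ

theorem contDiff_cons {m : WithTop ℕ∞} :
    ContDiff ℝ m fun q : ℝ × (Fin n → ℝ) => (Fin.cons q.1 q.2 : Fin (n + 1) → ℝ) :=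
  contDiff_pi.2 fun i => by
    refine Fin.cases ?_ (fun j => ?_) i
    · simpa using contDiff_fst
    · simp only [Fin.cons_succ]
      exact (contDiff_apply ℝ ℝ j).comp contDiff_snd

theorem isOpen_openCollar (hU : IsOpen U) : IsOpen (openCollar ε U) :=
  (isOpen_Ioo.preimage (continuous_apply 0)).inter
    (hU.preimage (contDiff_tail (m := 0)).continuous)

theorem collar_mem_nhds (hU : IsOpen U) {p : Fin (n + 1) → ℝ} (hp : p ∈ openCollar ε U) :
    collar ε U ∈ 𝓝 p :=
  mem_of_superset ((isOpen_openCollar hU).mem_nhds hp) openCollar_subset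

/-- The collar is the intersection of an open set with a closed half space, which is convex with
nonempty interior. -/
theorem uniqueDiffOn_collar (hU : IsOpen U) : UniqueDiffOn ℝ (collar ε U) := by
  have h1 : UniqueDiffOn ℝ {p : Fin (n + 1) → ℝ | 0 ≤ p 0} := by
    refine uniqueDiffOn_convex ?_ ⟨fun _ => 1, ?_⟩
    · intro p hp q hq a b ha hb _
      have hp : 0 ≤ p 0 := hp
      have hq : 0 ≤ q 0 := hq
      simp only [mem_ofPred_eq, Pi.add_apply, Pi.smul_apply, smul_eq_mul]
      positivity
    · have : IsOpen {p : Fin (n + 1) → ℝ | 0 < p 0} :=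
        isOpen_lt continuous_const (continuous_apply 0)
      have hsub : {p : Fin (n + 1) → ℝ | 0 < p 0} ⊆ {p : Fin (n + 1) → ℝ | 0 ≤ p 0} := by
        intro p hp
        rw [mem_ofPred_eq] at hp ⊢
        exact hp.le
      exact interior_maximal hsub this (by simp)
  have h2 : IsOpen {p : Fin (n + 1) → ℝ | p 0 < ε ∧ Fin.tail p ∈ U} :=
    (isOpen_lt (continuous_apply 0) continuous_const).inter
      (hU.preimage (contDiff_tail (m := 0)).continuous)
  have : collar ε U = {p : Fin (n + 1) → ℝ | 0 ≤ p 0}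
      ∩ {p : Fin (n + 1) → ℝ | p 0 < ε ∧ Fin.tail p ∈ U} := by
    ext p
    simp only [collar, mem_Ico, mem_ofPred_eq, mem_inter_iff]
    tauto
  rw [this]
  exact h1.inter h2

theorem hasFDerivAt_cons_right (r : ℝ) (x : Fin n → ℝ) :
    HasFDerivAt (fun y : Fin n → ℝ => (Fin.cons r y : Fin (n + 1) → ℝ))
      (ContinuousLinearMap.pi (Fin.cons (α := fun _ => (Fin n → ℝ) →L[ℝ] ℝ) 0
        fun j => ContinuousLinearMap.proj (R := ℝ) (φ := fun _ : Fin n => ℝ) j)) x := by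
  refine hasFDerivAt_pi.2 fun i => ?_
  refine Fin.cases ?_ (fun j => ?_) i
  · simp only [Fin.cons_zero]
    exact hasFDerivAt_const r x
  · simp only [Fin.cons_succ]
    exact (ContinuousLinearMap.proj (R := ℝ) (φ := fun _ : Fin n => ℝ) j).hasFDerivAt

theorem hasDerivAt_cons_left (r : ℝ) (x : Fin n → ℝ) :
    HasDerivAt (fun s : ℝ => (Fin.cons s x : Fin (n + 1) → ℝ)) (Pi.single 0 1) r := by
  refine hasDerivAt_pi.2 fun i => ?_
  refine Fin.cases ?_ (fun j => ?_) i
  · simp only [Fin.cons_zero, Pi.single_eq_same]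
    exact hasDerivAt_id r
  · simp only [Fin.cons_succ, ne_eq, Fin.succ_ne_zero, not_false_eq_true, Pi.single_eq_of_ne]
    exact hasDerivAt_const r (x j)

/-- A slice of constant r stays in the collar and is open in x, so tangential derivatives within the
collar are ordinary partial derivatives of the slice, even at r = 0. -/
theorem pdWithin_succ_collar (hU : IsOpen U) {F : (Fin (n + 1) → ℝ) → ℝ} {r : ℝ} {x : Fin n → ℝ}
    (hr : r ∈ Ico 0 ε) (hx : x ∈ U)
    (hF : DifferentiableWithinAt ℝ F (collar ε U) (Fin.cons r x)) (i : Fin n) :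
    pdWithin (collar ε U) i.succ F (Fin.cons r x) = pd i (fun y => F (Fin.cons r y)) x := by
  have h := hF.hasFDerivWithinAt.comp x (hasFDerivAt_cons_right r x).hasFDerivWithinAt (s := U)
    fun y hy => cons_mem_collar hr hy
  have h' := h.hasFDerivAt (hU.mem_nhds hx)
  rw [pd]
  change _ = fderiv ℝ (F ∘ fun y : Fin n → ℝ => (Fin.cons r y : Fin (n + 1) → ℝ)) x _
  rw [h'.fderiv, pdWithin, ContinuousLinearMap.comp_apply]
  congr 1
  funext k
  refine Fin.cases ?_ (fun j => ?_) k
  · simp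
  · simp [Pi.single_apply]

theorem pd_succ_cons {F : (Fin (n + 1) → ℝ) → ℝ} {r : ℝ} {x : Fin n → ℝ}
    (hF : DifferentiableAt ℝ F (Fin.cons r x)) (i : Fin n) :
    pd i.succ F (Fin.cons r x) = pd i (fun y => F (Fin.cons r y)) x := by
  have h' := hF.hasFDerivAt.comp x (hasFDerivAt_cons_right r x)
  rw [pd, pd]
  change _ = fderiv ℝ (F ∘ fun y : Fin n → ℝ => (Fin.cons r y : Fin (n + 1) → ℝ)) x _
  rw [h'.fderiv, ContinuousLinearMap.comp_apply]
  congr 1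
  funext k
  refine Fin.cases ?_ (fun j => ?_) k
  · simp
  · simp [Pi.single_apply]

theorem hasDerivAt_cons {F : (Fin (n + 1) → ℝ) → ℝ} {r : ℝ} {x : Fin n → ℝ}
    (hF : DifferentiableAt ℝ F (Fin.cons r x)) :
    HasDerivAt (fun s : ℝ => F (Fin.cons s x)) (pd 0 F (Fin.cons r x)) r :=
  hF.hasFDerivAt.comp_hasDerivAt r (hasDerivAt_cons_left r x)

theorem contDiffOn_cons_right {F : (Fin (n + 1) → ℝ) → ℝ} {m : WithTop ℕ∞}
    (hF : ContDiffOn ℝ m F (collar ε U)) {r : ℝ} (hr : r ∈ Ico 0 ε) :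
    ContDiffOn ℝ m (fun x : Fin n → ℝ => F (Fin.cons r x)) U :=
  hF.comp (contDiff_cons.comp (contDiff_prodMk_right r)).contDiffOn
    fun _ hx => cons_mem_collar hr hx

theorem contDiffOn_cons_left {F : (Fin (n + 1) → ℝ) → ℝ} {m : WithTop ℕ∞}
    (hF : ContDiffOn ℝ m F (collar ε U)) {x : Fin n → ℝ} (hx : x ∈ U) :
    ContDiffOn ℝ m (fun r : ℝ => F (Fin.cons r x)) (Ico 0 ε) :=
  hF.comp (contDiff_cons.comp (contDiff_prodMk_left x)).contDiffOn
    fun _ hr => cons_mem_collar hr hx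

theorem tendsto_cons_of_continuousOn (hε : 0 < ε) {F : (Fin (n + 1) → ℝ) → ℝ}
    (hF : ContinuousOn F (collar ε U)) {x : Fin n → ℝ} (hx : x ∈ U) :
    Tendsto (fun r : ℝ => F (Fin.cons r x)) (𝓝[>] 0) (𝓝 (F (Fin.cons 0 x))) :=
  tendsto_of_contDiffOn_Ico (m := 0) hε
    (by exact_mod_cast contDiffOn_cons_left (contDiffOn_zero.2 hF) hx)

end Collar

/-! ### Smoothness of the inverse matrix -/

section MatrixInverse

variable {E : Type*} [NormedAddCommGroup E] [NormedSpace ℝ E] {κ : Type*} [Fintype κ]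
  [DecidableEq κ] {s : Set E} {m : WithTop ℕ∞}

theorem contDiffOn_det {A : E → Matrix κ κ ℝ}
    (hA : ∀ i j, ContDiffOn ℝ m (fun x => A x i j) s) : ContDiffOn ℝ m (fun x => (A x).det) s := by
  simp only [Matrix.det_apply']
  exact ContDiffOn.sum fun σ _ => contDiffOn_const.mul (contDiffOn_prod fun i _ => hA _ _)

theorem contDiffOn_inv_matrix {A : E → Matrix κ κ ℝ}
    (hA : ∀ i j, ContDiffOn ℝ m (fun x => A x i j) s) (hdet : ∀ x ∈ s, (A x).det ≠ 0) (i j : κ) :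
    ContDiffOn ℝ m (fun x => (A x)⁻¹ i j) s := by
  -- Cramer's rule expresses the entries of the inverse as quotients of polynomials in the entries.
  have : ∀ x, (A x)⁻¹ i j = ((A x).det)⁻¹ * ((A x).updateRow j (Pi.single i 1)).det := by
    intro x
    rw [Matrix.inv_def, Matrix.smul_apply, Ring.inverse_eq_inv', smul_eq_mul,
      Matrix.adjugate_apply]
  simp only [this]
  refine ((contDiffOn_det hA).inv hdet).mul (contDiffOn_det fun a b => ?_)
  simp only [Matrix.updateRow_apply]
  split_ifs
  · exact contDiffOn_const
  · exact hA a b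

end MatrixInverse

/-! ### Curvature with derivatives taken within a set -/

section WithinCurvature

variable {ι : Type} [Fintype ι] [DecidableEq ι]

/-- The Christoffel symbols, with derivatives taken within `S`. -/
noncomputable def christoffelWithin (S : Set (ι → ℝ)) (g : (ι → ℝ) → Matrix ι ι ℝ) (k i j : ι)
    (x : ι → ℝ) : ℝ :=
  (1 / 2) * ∑ l, (g x)⁻¹ k l *
    (pdWithin S i (fun y => g y j l) x + pdWithin S j (fun y => g y i l) x
      - pdWithin S l (fun y => g y i j) x)

/-- The Ricci tensor, with derivatives taken within `S`. -/
noncomputable def ricciWithin (S : Set (ι → ℝ)) (g : (ι → ℝ) → Matrix ι ι ℝ) (i j : ι)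
    (x : ι → ℝ) : ℝ :=
  ∑ k, (pdWithin S k (christoffelWithin S g k i j) x - pdWithin S j (christoffelWithin S g k i k) x
    + ∑ l, (christoffelWithin S g k k l x * christoffelWithin S g l i j x
      - christoffelWithin S g k j l x * christoffelWithin S g l i k x))

/-- The scalar curvature, with derivatives taken within `S`. -/
noncomputable def scalarCurvWithin (S : Set (ι → ℝ)) (g : (ι → ℝ) → Matrix ι ι ℝ)
    (x : ι → ℝ) : ℝ :=
  ∑ i, ∑ j, (g x)⁻¹ i j * ricciWithin S g i j x

variable {S O : Set (ι → ℝ)} {g : (ι → ℝ) → Matrix ι ι ℝ}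

/-- This and the next two lemmas show that the curvature built from derivatives within S agrees with
the ordinary one on open subsets. With S the collar, it therefore extends the curvature from r > 0
to r = 0. -/
theorem christoffelWithin_eq (hO : IsOpen O) (hOS : O ⊆ S) {x : ι → ℝ} (hx : x ∈ O) (k i j : ι) :
    christoffelWithin S g k i j x = christoffel g k i j x := by
  have h : S ∈ 𝓝 x := mem_of_superset (hO.mem_nhds hx) hOS
  simp only [christoffelWithin, christoffel, pdWithin_of_mem_nhds h]

theorem ricciWithin_eq (hO : IsOpen O) (hOS : O ⊆ S) {x : ι → ℝ} (hx : x ∈ O) (i j : ι) :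
    ricciWithin S g i j x = ricci g i j x := by
  have h : S ∈ 𝓝 x := mem_of_superset (hO.mem_nhds hx) hOS
  have hc : ∀ a k i j, pd a (christoffelWithin S g k i j) x = pd a (christoffel g k i j) x :=
    fun a k i j => pd_congr (by
      filter_upwards [hO.mem_nhds hx] with y hy using christoffelWithin_eq hO hOS hy k i j)
  simp only [ricciWithin, ricci, pdWithin_of_mem_nhds h, christoffelWithin_eq hO hOS hx, hc]

theorem scalarCurvWithin_eq (hO : IsOpen O) (hOS : O ⊆ S) {x : ι → ℝ} (hx : x ∈ O) :
    scalarCurvWithin S g x = scalarCurv g x := by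
  simp only [scalarCurvWithin, scalarCurv, ricciWithin_eq hO hOS hx]

end WithinCurvature

/-! ### Regularity of the curvature up to the boundary -/

section Regularity

variable {n : ℕ} {S : Set (Fin (n + 1) → ℝ)}

/-- Functions of class `C^2` on `S` whose first derivatives have an `r^2 log r` term at most. -/
def IsC2LogSum (S : Set (Fin (n + 1) → ℝ)) (f : (Fin (n + 1) → ℝ) → ℝ) : Prop :=
  ContDiffOn ℝ (2 : ℕ) f S ∧ ∀ i, IsLogSum S 2 2 (pdWithin S i f)

variable {f g : (Fin (n + 1) → ℝ) → ℝ}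

theorem differentiableOn_of_contDiffOn_two (hf : ContDiffOn ℝ (2 : ℕ) f S) :
    DifferentiableOn ℝ f S :=
  hf.differentiableOn (by norm_num)

theorem isC2LogSum_of_contDiffOn (hS : UniqueDiffOn ℝ S) (hf : ContDiffOn ℝ (3 : ℕ) f S) :
    IsC2LogSum S f :=
  ⟨hf.of_le (by norm_num), fun _ => isLogSum_of_contDiffOn (contDiffOn_pdWithin (m := 2) hS hf)⟩

theorem IsC2LogSum.add (hS : UniqueDiffOn ℝ S) (hf : IsC2LogSum S f) (hg : IsC2LogSum S g) :
    IsC2LogSum S fun p => f p + g p :=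
  ⟨hf.1.add hg.1, fun i => ((hf.2 i).add (hg.2 i)).congr fun p hp =>
    pdWithin_add hS hp (differentiableOn_of_contDiffOn_two hf.1 p hp)
      (differentiableOn_of_contDiffOn_two hg.1 p hp)⟩

/-- A product of two log sums would contain log². Here the Leibniz rule only multiplies the log sum
of one derivative by the other factor, which is C², so the class is closed under products. -/
theorem IsC2LogSum.mul (hS : UniqueDiffOn ℝ S) (hf : IsC2LogSum S f) (hg : IsC2LogSum S g) :
    IsC2LogSum S fun p => f p * g p :=
  ⟨hf.1.mul hg.1, fun i => (((hg.2 i).mul_left hf.1).add ((hf.2 i).mul_left hg.1)).congr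
    fun p hp => pdWithin_mul hS hp (differentiableOn_of_contDiffOn_two hf.1 p hp)
      (differentiableOn_of_contDiffOn_two hg.1 p hp)⟩

theorem isC2LogSum_const (hS : UniqueDiffOn ℝ S) (c : ℝ) : IsC2LogSum S fun _ => c :=
  isC2LogSum_of_contDiffOn hS contDiffOn_const

theorem IsC2LogSum.const_mul (hS : UniqueDiffOn ℝ S) (hf : IsC2LogSum S f) (c : ℝ) :
    IsC2LogSum S fun p => c * f p :=
  (isC2LogSum_const hS c).mul hS hf

theorem IsC2LogSum.sub (hS : UniqueDiffOn ℝ S) (hf : IsC2LogSum S f) (hg : IsC2LogSum S g) :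
    IsC2LogSum S fun p => f p - g p := by
  have := hf.add hS (hg.const_mul hS (-1))
  simpa only [neg_one_mul, ← sub_eq_add_neg] using this

theorem IsC2LogSum.sum (hS : UniqueDiffOn ℝ S) {κ : Type*} (s : Finset κ)
    {F : κ → (Fin (n + 1) → ℝ) → ℝ} (hF : ∀ a ∈ s, IsC2LogSum S (F a)) :
    IsC2LogSum S fun p => ∑ a ∈ s, F a p := by
  classical
  induction s using Finset.induction_on with
  | empty => simpa using isC2LogSum_const hS 0
  | insert a s ha ih =>
    simp only [Finset.sum_insert ha]
    exact (hF a (Finset.mem_insert_self a s)).add hS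
      (ih fun b hb => hF b (Finset.mem_insert_of_mem hb))

/-- First derivatives have an r³ log r term, which is C²; second derivatives have an r² log r term
with C³ coefficients. -/
theorem IsLogSum.isC2LogSum_pdWithin (hS : UniqueDiffOn ℝ S) (hf : IsLogSum S 4 5 f)
    (i : Fin (n + 1)) : IsC2LogSum S (QCurv.pdWithin S i f) :=
  ⟨((hf.pdWithin hS i).mono (j' := 2) le_rfl (by norm_num)).contDiffOn le_rfl,
    fun l => ((hf.pdWithin hS i).pdWithin hS l).mono le_rfl (by norm_num)⟩

variable {G : (Fin (n + 1) → ℝ) → Matrix (Fin (n + 1)) (Fin (n + 1)) ℝ}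

theorem isC2LogSum_christoffelWithin (hS : UniqueDiffOn ℝ S)
    (hG : ∀ i j, IsLogSum S 4 5 fun p => G p i j)
    (hinv : ∀ i j, ContDiffOn ℝ (3 : ℕ) (fun p => (G p)⁻¹ i j) S) (k i j : Fin (n + 1)) :
    IsC2LogSum S (christoffelWithin S G k i j) :=
  (IsC2LogSum.sum hS _ fun l _ => (isC2LogSum_of_contDiffOn hS (hinv k l)).mul hS
    ((((hG j l).isC2LogSum_pdWithin hS i).add hS ((hG i l).isC2LogSum_pdWithin hS j)).sub hS
      ((hG i j).isC2LogSum_pdWithin hS l))).const_mul hS _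

/-- Only the derivatives of the Christoffel symbols carry logarithms; the quadratic terms are C²
outright. -/
theorem isLogSum_ricciWithin (hS : UniqueDiffOn ℝ S)
    (hG : ∀ i j, IsLogSum S 4 5 fun p => G p i j)
    (hinv : ∀ i j, ContDiffOn ℝ (3 : ℕ) (fun p => (G p)⁻¹ i j) S) (i j : Fin (n + 1)) :
    IsLogSum S 2 2 (ricciWithin S G i j) := by
  have hC := isC2LogSum_christoffelWithin hS hG hinv
  exact IsLogSum.sum _ fun k _ => (((hC k i j).2 k).sub ((hC k i k).2 j)).add
    (IsLogSum.sum _ fun l _ => isLogSum_of_contDiffOn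
      (((hC k k l).1.mul (hC l i j).1).sub ((hC k j l).1.mul (hC l i k).1)))

theorem isLogSum_scalarCurvWithin (hS : UniqueDiffOn ℝ S)
    (hG : ∀ i j, IsLogSum S 4 5 fun p => G p i j)
    (hinv : ∀ i j, ContDiffOn ℝ (3 : ℕ) (fun p => (G p)⁻¹ i j) S) :
    IsLogSum S 2 2 (scalarCurvWithin S G) :=
  IsLogSum.sum _ fun i _ => IsLogSum.sum _ fun j _ =>
    (isLogSum_ricciWithin hS hG hinv i j).mul_left ((hinv i j).of_le (by norm_num))

end Regularity

/-! ### Families of metrics which are regular up to the boundary -/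

section Family

variable {n : ℕ}

/-- Families `h_r`, `0 ≤ r < ε`, of metrics on `U`, of class `C^5` up to an `r^4 log r` term. -/
structure IsRegularFamily (ε : ℝ) (U : Set (Fin n → ℝ))
    (h : ℝ → (Fin n → ℝ) → Matrix (Fin n) (Fin n) ℝ) : Prop where
  pos : 0 < ε
  isOpen : IsOpen U
  symm : ∀ r ∈ Ico 0 ε, ∀ x ∈ U, ∀ i j, h r x i j = h r x j i
  det_ne : ∀ r ∈ Ico 0 ε, ∀ x ∈ U, (h r x).det ≠ 0
  isLogSum : ∀ i j, IsLogSum (collar ε U) 4 5 fun p => h (p 0) (Fin.tail p) i j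

variable {ε : ℝ} {U : Set (Fin n → ℝ)} {h : ℝ → (Fin n → ℝ) → Matrix (Fin n) (Fin n) ℝ}

@[simp]
theorem cylMetric_zero_zero (p : Fin (n + 1) → ℝ) : cylMetric h p 0 0 = 1 := rfl

@[simp]
theorem cylMetric_zero_succ (p : Fin (n + 1) → ℝ) (i : Fin n) : cylMetric h p 0 i.succ = 0 := rfl

@[simp]
theorem cylMetric_succ_zero (p : Fin (n + 1) → ℝ) (i : Fin n) : cylMetric h p i.succ 0 = 0 := rfl

@[simp]
theorem cylMetric_succ_succ (p : Fin (n + 1) → ℝ) (i j : Fin n) :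
    cylMetric h p i.succ j.succ = h (p 0) (Fin.tail p) i j := rfl

theorem smul_cylMetric_inv {c : ℝ} (hc : c ≠ 0) {p : Fin (n + 1) → ℝ}
    (hdet : (h (p 0) (Fin.tail p)).det ≠ 0) :
    (c • cylMetric h p)⁻¹ = c⁻¹ • cylMetric (fun r x => (h r x)⁻¹) p := by
  apply Matrix.inv_eq_right_inv
  have key := Matrix.mul_nonsing_inv _ (isUnit_iff_ne_zero.2 hdet)
  ext a b
  rw [Matrix.smul_mul, Matrix.mul_smul, smul_smul, mul_inv_cancel₀ hc, one_smul, Matrix.mul_apply,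
    Fin.sum_univ_succ]
  refine Fin.cases ?_ (fun i => ?_) a <;> refine Fin.cases ?_ (fun j => ?_) b
  · simp
  · simp [(Fin.succ_ne_zero j).symm]
  · simp
  · have := congrFun (congrFun key i) j
    rw [Matrix.mul_apply] at this
    simp [this, Matrix.one_apply]

theorem cylMetric_inv {p : Fin (n + 1) → ℝ} (hdet : (h (p 0) (Fin.tail p)).det ≠ 0) :
    (cylMetric h p)⁻¹ = cylMetric (fun r x => (h r x)⁻¹) p := by
  simpa using smul_cylMetric_inv one_ne_zero hdet

namespace IsRegularFamily

variable (hh : IsRegularFamily ε U h)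
include hh

theorem uniqueDiffOn : UniqueDiffOn ℝ (collar ε U) := uniqueDiffOn_collar hh.isOpen

/-- The function r⁴ log r is only C³, which caps the regularity of the metric at 3. -/
theorem contDiffOn (i j : Fin n) :
    ContDiffOn ℝ (3 : ℕ) (fun p => h (p 0) (Fin.tail p) i j) (collar ε U) :=
  ((hh.isLogSum i j).mono le_rfl (by norm_num : 3 ≤ 5)).contDiffOn le_rfl

theorem contDiffOn_inv (i j : Fin n) :
    ContDiffOn ℝ (3 : ℕ) (fun p => (h (p 0) (Fin.tail p))⁻¹ i j) (collar ε U) :=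
  contDiffOn_inv_matrix hh.contDiffOn (fun _ hp => hh.det_ne _ hp.1 _ hp.2) i j

theorem isLogSum_cylMetric (a b : Fin (n + 1)) :
    IsLogSum (collar ε U) 4 5 fun p => cylMetric h p a b := by
  refine Fin.cases ?_ (fun i => ?_) a <;> refine Fin.cases ?_ (fun j => ?_) b
  · exact isLogSum_of_contDiffOn contDiffOn_const
  · exact isLogSum_of_contDiffOn contDiffOn_const
  · exact isLogSum_of_contDiffOn contDiffOn_const
  · exact hh.isLogSum i j

theorem contDiffOn_cylMetric_inv (a b : Fin (n + 1)) :
    ContDiffOn ℝ (3 : ℕ) (fun p => (cylMetric h p)⁻¹ a b) (collar ε U) := by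
  have : ∀ p ∈ collar ε U,
      (cylMetric h p)⁻¹ a b = cylMetric (fun r x => (h r x)⁻¹) p a b := fun _ hp => by
    rw [cylMetric_inv (hh.det_ne _ hp.1 _ hp.2)]
  refine ContDiffOn.congr ?_ this
  refine Fin.cases ?_ (fun i => ?_) a <;> refine Fin.cases ?_ (fun j => ?_) b
  · exact contDiffOn_const
  · exact contDiffOn_const
  · exact contDiffOn_const
  · exact hh.contDiffOn_inv i j

/-- Up to the boundary, `J` of `dr^2 + h_r` has an `r^2 log r` term at most. -/
theorem exists_isLogSum_J_cylMetric :
    ∃ F, IsLogSum (collar ε U) 2 2 F ∧ ∀ p ∈ openCollar ε U, J (cylMetric h) p = F p := by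
  refine ⟨fun p => (2 * ((Fintype.card (Fin (n + 1)) : ℝ) - 1))⁻¹
    * scalarCurvWithin (collar ε U) (cylMetric h) p,
    (isLogSum_scalarCurvWithin hh.uniqueDiffOn hh.isLogSum_cylMetric
      hh.contDiffOn_cylMetric_inv).const_mul _, fun p hp => ?_⟩
  simp only [scalarCurvWithin_eq (isOpen_openCollar hh.isOpen) openCollar_subset hp, J,
    div_eq_inv_mul]

/-- The Christoffel symbols of `h_r` are of class `C^2` up to the boundary. -/
theorem contDiffOn_christoffel_slice (k i j : Fin n) :
    ContDiffOn ℝ (2 : ℕ) (fun p => christoffel (h (p 0)) k i j (Fin.tail p)) (collar ε U) := by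
  have hd : ∀ i j, DifferentiableOn ℝ (fun p => h (p 0) (Fin.tail p) i j) (collar ε U) :=
    fun i j => (hh.contDiffOn i j).differentiableOn (by norm_num)
  have hpd : ∀ l i j, ∀ p ∈ collar ε U, pd l (fun y => h (p 0) y i j) (Fin.tail p)
      = pdWithin (collar ε U) l.succ (fun p => h (p 0) (Fin.tail p) i j) p := by
    intro l i j p hp
    obtain ⟨r, x, rfl⟩ : ∃ r x, p = Fin.cons r x := ⟨_, _, (Fin.cons_self_tail p).symm⟩
    have hp' := hp
    simp only [collar, mem_ofPred_eq, Fin.cons_zero, Fin.tail_cons] at hp'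
    rw [pdWithin_succ_collar hh.isOpen hp'.1 hp'.2 (hd i j _ hp)]
    simp
  have hc : ∀ l i j, ContDiffOn ℝ (2 : ℕ)
      (pdWithin (collar ε U) (Fin.succ l) (fun p => h (p 0) (Fin.tail p) i j)) (collar ε U) :=
    fun l i j => contDiffOn_pdWithin hh.uniqueDiffOn (hh.contDiffOn i j)
  have : ContDiffOn ℝ (2 : ℕ) (fun p => (1 / 2) * ∑ l, (h (p 0) (Fin.tail p))⁻¹ k l *
      (pdWithin (collar ε U) i.succ (fun p => h (p 0) (Fin.tail p) j l) p
        + pdWithin (collar ε U) j.succ (fun p => h (p 0) (Fin.tail p) i l) p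
        - pdWithin (collar ε U) l.succ (fun p => h (p 0) (Fin.tail p) i j) p)) (collar ε U) :=
    contDiffOn_const.mul (ContDiffOn.sum fun l _ => ((hh.contDiffOn_inv k l).of_le
      (by norm_num)).mul (((hc i j l).add (hc j i l)).sub (hc l i j)))
  refine this.congr fun p hp => ?_
  simp only [christoffel]
  congr 1
  refine Finset.sum_congr rfl fun l _ => ?_
  rw [hpd _ _ _ p hp, hpd _ _ _ p hp, hpd _ _ _ p hp]

/-- The Ricci tensor of `h_r` is continuous up to the boundary. -/
theorem continuousOn_ricci_slice (i j : Fin n) :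
    ContinuousOn (fun p => ricci (h (p 0)) i j (Fin.tail p)) (collar ε U) := by
  have hC := hh.contDiffOn_christoffel_slice
  have hpd : ∀ a k i j, ∀ p ∈ collar ε U, pd a (christoffel (h (p 0)) k i j) (Fin.tail p)
      = pdWithin (collar ε U) a.succ (fun p => christoffel (h (p 0)) k i j (Fin.tail p)) p := by
    intro a k i j p hp
    obtain ⟨r, x, rfl⟩ : ∃ r x, p = Fin.cons r x := ⟨_, _, (Fin.cons_self_tail p).symm⟩
    have hp' := hp
    simp only [collar, mem_ofPred_eq, Fin.cons_zero, Fin.tail_cons] at hp'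
    rw [pdWithin_succ_collar hh.isOpen hp'.1 hp'.2
      (differentiableOn_of_contDiffOn_two (hC k i j) _ hp)]
    simp
  have hc : ∀ a k i j, ContinuousOn (pdWithin (collar ε U) (Fin.succ a)
      (fun p => christoffel (h (p 0)) k i j (Fin.tail p))) (collar ε U) :=
    fun a k i j => (contDiffOn_pdWithin (m := 1) hh.uniqueDiffOn (hC k i j)).continuousOn
  have hC' := fun k i j => (hC k i j).continuousOn
  have : ContinuousOn (fun p => ∑ k,
      (pdWithin (collar ε U) (Fin.succ k)
          (fun p => christoffel (h (p 0)) k i j (Fin.tail p)) p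
        - pdWithin (collar ε U) (Fin.succ j)
          (fun p => christoffel (h (p 0)) k i k (Fin.tail p)) p
        + ∑ l, (christoffel (h (p 0)) k k l (Fin.tail p) * christoffel (h (p 0)) l i j (Fin.tail p)
          - christoffel (h (p 0)) k j l (Fin.tail p)
            * christoffel (h (p 0)) l i k (Fin.tail p)))) (collar ε U) :=
    continuousOn_finsetSum _ fun k _ => ((hc k k i j).sub (hc j k i k)).add
      (continuousOn_finsetSum _ fun l _ =>
        ((hC' k k l).mul (hC' l i j)).sub ((hC' k j l).mul (hC' l i k)))
  refine this.congr fun p hp => ?_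
  simp only [ricci]
  refine Finset.sum_congr rfl fun k _ => ?_
  rw [hpd _ _ _ _ p hp, hpd _ _ _ _ p hp]

end IsRegularFamily

end Family

/-! ### The curvature of `c(r) (dr^2 + h_r)` -/

section Warped

variable {n : ℕ} {ε : ℝ} {U : Set (Fin n → ℝ)} {h : ℝ → (Fin n → ℝ) → Matrix (Fin n) (Fin n) ℝ}

/-- The component `h_{ij}` as a function of `(r, x)`. -/
def component (h : ℝ → (Fin n → ℝ) → Matrix (Fin n) (Fin n) ℝ) (i j : Fin n)
    (p : Fin (n + 1) → ℝ) : ℝ :=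
  h (p 0) (Fin.tail p) i j

/-- The derivative `∂_r h_{ij}`. -/
noncomputable def rDeriv (h : ℝ → (Fin n → ℝ) → Matrix (Fin n) (Fin n) ℝ) (i j : Fin n) :
    (Fin (n + 1) → ℝ) → ℝ :=
  pd 0 (component h i j)

/-- The endomorphism `h_r^{-1} ∂_r h_r`. -/
noncomputable def shape (h : ℝ → (Fin n → ℝ) → Matrix (Fin n) (Fin n) ℝ) (i j : Fin n)
    (p : Fin (n + 1) → ℝ) : ℝ :=
  ∑ l, (h (p 0) (Fin.tail p))⁻¹ i l * rDeriv h l j p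

/-- The mean curvature `tr (h_r^{-1} ∂_r h_r) / 2` of the level sets of `r`. -/
noncomputable def meanCurv (h : ℝ → (Fin n → ℝ) → Matrix (Fin n) (Fin n) ℝ)
    (p : Fin (n + 1) → ℝ) : ℝ :=
  (1 / 2) * ∑ i, shape h i i p

/-- The metric `c(r) (dr^2 + h_r)`. -/
noncomputable def warped (c : ℝ → ℝ) (h : ℝ → (Fin n → ℝ) → Matrix (Fin n) (Fin n) ℝ)
    (p : Fin (n + 1) → ℝ) : Matrix (Fin (n + 1)) (Fin (n + 1)) ℝ :=
  c (p 0) • cylMetric h p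

namespace IsRegularFamily

variable (hh : IsRegularFamily ε U h)
include hh

theorem openCollar_mem_nhds {p : Fin (n + 1) → ℝ} (hp : p ∈ openCollar ε U) :
    openCollar ε U ∈ 𝓝 p :=
  (isOpen_openCollar hh.isOpen).mem_nhds hp

theorem differentiableAt_component {p : Fin (n + 1) → ℝ} (hp : p ∈ openCollar ε U) (i j : Fin n) :
    DifferentiableAt ℝ (component h i j) p :=
  ((hh.contDiffOn i j).differentiableOn (by norm_num)).differentiableAt
    (collar_mem_nhds hh.isOpen hp)

theorem contDiffOn_rDeriv (i j : Fin n) :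
    ContDiffOn ℝ (2 : ℕ) (rDeriv h i j) (openCollar ε U) := by
  refine ((contDiffOn_pdWithin (i := 0) hh.uniqueDiffOn (hh.contDiffOn i j)).mono
    openCollar_subset).congr fun p hp => ?_
  rw [pdWithin_of_mem_nhds (collar_mem_nhds hh.isOpen hp)]
  rfl

theorem differentiableAt_rDeriv {p : Fin (n + 1) → ℝ} (hp : p ∈ openCollar ε U) (i j : Fin n) :
    DifferentiableAt ℝ (rDeriv h i j) p :=
  ((hh.contDiffOn_rDeriv i j).differentiableOn (by norm_num)).differentiableAt
    (hh.openCollar_mem_nhds hp)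

theorem contDiffOn_shape (i j : Fin n) :
    ContDiffOn ℝ (2 : ℕ) (shape h i j) (openCollar ε U) :=
  ContDiffOn.sum fun l _ => (((hh.contDiffOn_inv i l).of_le (by norm_num)).mono
    openCollar_subset).mul (hh.contDiffOn_rDeriv l j)

theorem differentiableAt_shape {p : Fin (n + 1) → ℝ} (hp : p ∈ openCollar ε U) (i j : Fin n) :
    DifferentiableAt ℝ (shape h i j) p :=
  ((hh.contDiffOn_shape i j).differentiableOn (by norm_num)).differentiableAt
    (hh.openCollar_mem_nhds hp)

theorem rDeriv_symm {p : Fin (n + 1) → ℝ} (hp : p ∈ openCollar ε U) (i j : Fin n) :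
    rDeriv h i j p = rDeriv h j i p := by
  refine pd_congr ?_
  filter_upwards [hh.openCollar_mem_nhds hp] with q hq
  exact hh.symm _ (Ioo_subset_Ico_self hq.1) _ hq.2 i j

theorem sum_inv_mul_component {p : Fin (n + 1) → ℝ} (hp : p ∈ collar ε U) (k i : Fin n) :
    ∑ l, (h (p 0) (Fin.tail p))⁻¹ k l * component h i l p = if k = i then 1 else 0 := by
  have key := congrFun (congrFun (Matrix.nonsing_inv_mul _
    (isUnit_iff_ne_zero.2 (hh.det_ne _ hp.1 _ hp.2))) k) i
  rw [Matrix.mul_apply, Matrix.one_apply] at key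
  rw [← key]
  exact Finset.sum_congr rfl fun l _ => by rw [component, hh.symm _ hp.1 _ hp.2]

theorem sum_component_mul_shape {p : Fin (n + 1) → ℝ} (hp : p ∈ collar ε U) (i j : Fin n) :
    ∑ l, component h i l p * shape h l j p = rDeriv h i j p := by
  have key : ∀ m, ∑ l, component h i l p * (h (p 0) (Fin.tail p))⁻¹ l m
      = if i = m then 1 else 0 := fun m => by
    have := congrFun (congrFun (Matrix.mul_nonsing_inv _
      (isUnit_iff_ne_zero.2 (hh.det_ne _ hp.1 _ hp.2))) i) m
    rwa [Matrix.mul_apply, Matrix.one_apply] at this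
  simp only [shape, Finset.mul_sum]
  rw [Finset.sum_comm]
  simp only [← mul_assoc, ← Finset.sum_mul, key]
  simp

-- Here m is the logarithmic derivative of c. One computation serves both metrics: c = 1, m = 0
-- gives dr² + h_r, and c = r⁻², m = -2/r gives the Poincaré metric.
variable {c m m' : ℝ → ℝ} (hc0 : ∀ r ∈ Ioo 0 ε, c r ≠ 0)
  (hc : ∀ r ∈ Ioo 0 ε, HasDerivAt c (m r * c r) r) (hm : ∀ r ∈ Ioo 0 ε, HasDerivAt m (m' r) r)

omit hh in
include hc in
theorem pd_warped_zero_zero {p : Fin (n + 1) → ℝ} (hp : p ∈ openCollar ε U) (a : Fin (n + 1)) :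
    pd a (fun q => warped c h q 0 0) p = if a = 0 then m (p 0) * c (p 0) else 0 := by
  have : (fun q => warped c h q 0 0) = fun q : Fin (n + 1) → ℝ => c (q 0) := by
    funext q; simp [warped]
  rw [this, pd_comp_coord (hc _ hp.1)]

omit hh in
theorem pd_warped_zero_succ (p : Fin (n + 1) → ℝ) (a : Fin (n + 1)) (i : Fin n) :
    pd a (fun q => warped c h q 0 i.succ) p = 0 := by
  simp [warped]

omit hh in
theorem pd_warped_succ_zero (p : Fin (n + 1) → ℝ) (a : Fin (n + 1)) (i : Fin n) :
    pd a (fun q => warped c h q i.succ 0) p = 0 := by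
  simp [warped]

include hc in
theorem pd_warped_succ_succ {p : Fin (n + 1) → ℝ} (hp : p ∈ openCollar ε U) (a : Fin (n + 1))
    (i j : Fin n) :
    pd a (fun q => warped c h q i.succ j.succ) p = c (p 0) * pd a (component h i j) p
      + component h i j p * (if a = 0 then m (p 0) * c (p 0) else 0) := by
  have hcd : DifferentiableAt ℝ (fun q : Fin (n + 1) → ℝ => c (q 0)) p :=
    (hc _ hp.1).differentiableAt.comp p (differentiableAt_apply 0 p)
  have : (fun q => warped c h q i.succ j.succ)
      = fun q : Fin (n + 1) → ℝ => c (q 0) * component h i j q := by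
    funext q; simp [warped, component]
  rw [this, pd_mul hcd (hh.differentiableAt_component hp i j), pd_comp_coord (hc _ hp.1)]

theorem pd_succ_component {p : Fin (n + 1) → ℝ} (hp : p ∈ openCollar ε U) (l i j : Fin n) :
    pd l.succ (component h i j) p = pd l (fun y => h (p 0) y i j) (Fin.tail p) := by
  have h1 := hh.differentiableAt_component hp i j
  obtain ⟨r, x, rfl⟩ : ∃ r x, p = Fin.cons r x := ⟨_, _, (Fin.cons_self_tail p).symm⟩
  rw [pd_succ_cons h1]
  simp [component]

include hc0 hc

theorem christoffel_warped_zero_zero_zero {p : Fin (n + 1) → ℝ} (hp : p ∈ openCollar ε U) :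
    christoffel (warped c h) 0 0 0 p = m (p 0) / 2 := by
  have hp' := openCollar_subset hp
  have := hc0 _ hp.1
  rw [christoffel, warped, smul_cylMetric_inv this (hh.det_ne _ hp'.1 _ hp'.2), Fin.sum_univ_succ]
  simp only [Matrix.smul_apply, cylMetric_zero_zero, cylMetric_zero_succ, smul_eq_mul,
    pd_warped_zero_zero hc hp]
  simp
  field_simp

theorem christoffel_warped_zero_zero_succ {p : Fin (n + 1) → ℝ} (hp : p ∈ openCollar ε U)
    (i : Fin n) : christoffel (warped c h) 0 0 i.succ p = 0 := by
  have hp' := openCollar_subset hp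
  have := hc0 _ hp.1
  rw [christoffel, warped, smul_cylMetric_inv this (hh.det_ne _ hp'.1 _ hp'.2), Fin.sum_univ_succ]
  simp only [Matrix.smul_apply, cylMetric_zero_zero, cylMetric_zero_succ, smul_eq_mul,
    pd_warped_zero_zero hc hp, pd_warped_zero_succ, pd_warped_succ_zero]
  simp

theorem christoffel_warped_zero_succ_zero {p : Fin (n + 1) → ℝ} (hp : p ∈ openCollar ε U)
    (i : Fin n) : christoffel (warped c h) 0 i.succ 0 p = 0 := by
  have hp' := openCollar_subset hp
  have := hc0 _ hp.1
  rw [christoffel, warped, smul_cylMetric_inv this (hh.det_ne _ hp'.1 _ hp'.2), Fin.sum_univ_succ]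
  simp only [Matrix.smul_apply, cylMetric_zero_zero, cylMetric_zero_succ, smul_eq_mul,
    pd_warped_zero_zero hc hp, pd_warped_zero_succ, pd_warped_succ_zero]
  simp

theorem christoffel_warped_zero_succ_succ {p : Fin (n + 1) → ℝ} (hp : p ∈ openCollar ε U)
    (i j : Fin n) : christoffel (warped c h) 0 i.succ j.succ p
      = -(rDeriv h i j p + m (p 0) * component h i j p) / 2 := by
  have hp' := openCollar_subset hp
  have := hc0 _ hp.1
  rw [christoffel, warped, smul_cylMetric_inv this (hh.det_ne _ hp'.1 _ hp'.2), Fin.sum_univ_succ]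
  simp only [Matrix.smul_apply, cylMetric_zero_zero, cylMetric_zero_succ, smul_eq_mul,
    pd_warped_succ_zero, hh.pd_warped_succ_succ hc hp]
  simp [rDeriv]
  field_simp

theorem christoffel_warped_succ_zero_zero {p : Fin (n + 1) → ℝ} (hp : p ∈ openCollar ε U)
    (k : Fin n) : christoffel (warped c h) k.succ 0 0 p = 0 := by
  have hp' := openCollar_subset hp
  have := hc0 _ hp.1
  rw [christoffel, warped, smul_cylMetric_inv this (hh.det_ne _ hp'.1 _ hp'.2), Fin.sum_univ_succ]
  simp only [Matrix.smul_apply, cylMetric_succ_zero, cylMetric_succ_succ, smul_eq_mul,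
    pd_warped_zero_succ, pd_warped_zero_zero hc hp]
  simp

theorem christoffel_warped_succ_zero_succ {p : Fin (n + 1) → ℝ} (hp : p ∈ openCollar ε U)
    (k i : Fin n) : christoffel (warped c h) k.succ 0 i.succ p
      = (shape h k i p + m (p 0) * if k = i then 1 else 0) / 2 := by
  have hp' := openCollar_subset hp
  have := hc0 _ hp.1
  -- Writing the Kronecker delta as the contraction of h⁻¹ with h turns both sides into sums over
  -- the same index, to be compared termwise.
  rw [christoffel, warped, smul_cylMetric_inv this (hh.det_ne _ hp'.1 _ hp'.2), Fin.sum_univ_succ,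
    ← hh.sum_inv_mul_component hp', shape, Finset.mul_sum, ← Finset.sum_add_distrib,
    Finset.sum_div]
  simp only [Matrix.smul_apply, cylMetric_succ_zero, cylMetric_succ_succ, smul_eq_mul,
    pd_warped_zero_succ, hh.pd_warped_succ_succ hc hp, mul_zero, zero_mul, zero_add, if_true,
    Finset.mul_sum]
  refine Finset.sum_congr rfl fun l _ => ?_
  rw [hh.rDeriv_symm hp l i, rDeriv]
  field_simp
  ring

theorem christoffel_warped_succ_succ_zero {p : Fin (n + 1) → ℝ} (hp : p ∈ openCollar ε U)
    (k i : Fin n) : christoffel (warped c h) k.succ i.succ 0 p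
      = (shape h k i p + m (p 0) * if k = i then 1 else 0) / 2 := by
  have hp' := openCollar_subset hp
  have := hc0 _ hp.1
  rw [christoffel, warped, smul_cylMetric_inv this (hh.det_ne _ hp'.1 _ hp'.2), Fin.sum_univ_succ,
    ← hh.sum_inv_mul_component hp', shape, Finset.mul_sum, ← Finset.sum_add_distrib,
    Finset.sum_div]
  simp only [Matrix.smul_apply, cylMetric_succ_zero, cylMetric_succ_succ, smul_eq_mul,
    pd_warped_zero_succ, pd_warped_succ_zero, hh.pd_warped_succ_succ hc hp, mul_zero, zero_mul,
    zero_add, if_true, Finset.mul_sum]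
  refine Finset.sum_congr rfl fun l _ => ?_
  rw [hh.rDeriv_symm hp l i, rDeriv]
  field_simp
  ring

/-- The conformal factor depends on r only, so it cancels between the inverse metric and tangential
derivatives. -/
theorem christoffel_warped_succ_succ_succ {p : Fin (n + 1) → ℝ} (hp : p ∈ openCollar ε U)
    (k i j : Fin n) : christoffel (warped c h) k.succ i.succ j.succ p
      = christoffel (h (p 0)) k i j (Fin.tail p) := by
  have hp' := openCollar_subset hp
  have := hc0 _ hp.1
  rw [christoffel, warped, smul_cylMetric_inv this (hh.det_ne _ hp'.1 _ hp'.2), Fin.sum_univ_succ,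
    christoffel]
  simp only [Matrix.smul_apply, cylMetric_succ_zero, cylMetric_succ_succ, smul_eq_mul,
    hh.pd_warped_succ_succ hc hp, mul_zero, zero_mul,
    zero_add, Fin.succ_ne_zero, if_false, add_zero, hh.pd_succ_component hp]
  congr 1
  refine Finset.sum_congr rfl fun l _ => ?_
  field_simp

end IsRegularFamily

end Warped

/-! ### Ricci tensor of c(r) (dr² + h_r) -/

section WarpedRicci

variable {n : ℕ} {ε : ℝ} {U : Set (Fin n → ℝ)} {h : ℝ → (Fin n → ℝ) → Matrix (Fin n) (Fin n) ℝ}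

namespace IsRegularFamily

variable (hh : IsRegularFamily ε U h)
  {c m m' : ℝ → ℝ} (hc0 : ∀ r ∈ Ioo 0 ε, c r ≠ 0)
  (hc : ∀ r ∈ Ioo 0 ε, HasDerivAt c (m r * c r) r) (hm : ∀ r ∈ Ioo 0 ε, HasDerivAt m (m' r) r)
include hh

theorem pd_meanCurv {p : Fin (n + 1) → ℝ} (hp : p ∈ openCollar ε U) (a : Fin (n + 1)) :
    pd a (meanCurv h) p = (1 / 2) * ∑ i, pd a (shape h i i) p := by
  have : meanCurv h = fun p => (1 / 2) * ∑ i, shape h i i p := rfl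
  rw [this, pd_const_mul, pd_sum _ fun i _ => hh.differentiableAt_shape hp i i]

include hc0 hc hm

/-- Traced Riccati equation: with W = (`shape` + m)/2 the block Γ^k_{0i}, the component is -∂_r tr W
- tr W² + (m/2) tr W, the last term coming from Γ^0_{00} = m/2. -/
theorem ricci_warped_zero_zero {p : Fin (n + 1) → ℝ} (hp : p ∈ openCollar ε U) :
    ricci (warped c h) 0 0 p = -pd 0 (meanCurv h) p - n * m' (p 0) / 2
      - m (p 0) / 2 * meanCurv h p - (1 / 4) * ∑ i, ∑ j, shape h i j p * shape h j i p := by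
  have h1 : ∀ k : Fin n, pd k.succ (christoffel (warped c h) k.succ 0 0) p = 0 := fun k => by
    rw [pd_congr (g := fun _ => 0), pd_const]
    filter_upwards [hh.openCollar_mem_nhds hp] with q hq
    exact hh.christoffel_warped_succ_zero_zero hc0 hc hq k
  have h2 : ∀ k : Fin n, pd 0 (christoffel (warped c h) k.succ 0 k.succ) p
      = (1 / 2) * (pd 0 (shape h k k) p + m' (p 0)) := fun k => by
    have hmd : DifferentiableAt ℝ (fun q : Fin (n + 1) → ℝ => m (q 0)) p :=
      (hm _ hp.1).differentiableAt.comp p (differentiableAt_apply 0 p)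
    rw [pd_congr (g := fun q => (1 / 2) * (shape h k k q + m (q 0))), pd_const_mul,
      pd_add (hh.differentiableAt_shape hp k k) hmd, pd_comp_coord (hm _ hp.1), if_pos rfl]
    filter_upwards [hh.openCollar_mem_nhds hp] with q hq
    rw [hh.christoffel_warped_succ_zero_succ hc0 hc hq, if_pos rfl]
    ring
  have h3 : ∀ k l : Fin n, (shape h k l p + m (p 0) * if k = l then 1 else 0) / 2
        * ((shape h l k p + m (p 0) * if l = k then 1 else 0) / 2)
      = (1 / 4) * (shape h k l p * shape h l k p)
        + (if k = l then m (p 0) / 2 * shape h k k p + m (p 0) ^ 2 / 4 else 0) := by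
    intro k l
    rcases eq_or_ne k l with rfl | hkl
    · simp only [if_true]; ring
    · simp only [hkl, hkl.symm, if_false]; ring
  rw [ricci, Fin.sum_univ_succ]
  simp only [Fin.sum_univ_succ, h1, h2, hh.christoffel_warped_zero_zero_zero hc0 hc hp,
    hh.christoffel_warped_zero_zero_succ hc0 hc hp, hh.christoffel_warped_succ_zero_zero hc0 hc hp, hh.christoffel_warped_succ_zero_succ hc0 hc hp,
    hh.christoffel_warped_succ_succ_zero hc0 hc hp, mul_zero, sub_self,
    add_zero, zero_add, Finset.sum_const_zero, zero_sub, if_true, h3, hh.pd_meanCurv hp,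
    Finset.sum_add_distrib, Finset.sum_neg_distrib, Finset.sum_sub_distrib, meanCurv, mul_one,
    Finset.sum_ite_eq, Finset.mem_univ, ← Finset.mul_sum, ← Finset.sum_mul, ← Finset.sum_div,
    Finset.sum_const, Finset.card_univ, Fintype.card_fin, nsmul_eq_mul]
  ring

/-- The purely tangential Christoffel symbols contribute Ric(h_r). The rest involves Γ^0_{ij} = -(h'
+ m h)/2: its r-derivative and its products with the symbols Γ^0_{00} and Γ^k_{i0}. -/
theorem ricci_warped_succ_succ {p : Fin (n + 1) → ℝ} (hp : p ∈ openCollar ε U) (i j : Fin n) :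
    ricci (warped c h) i.succ j.succ p = ricci (h (p 0)) i j (Fin.tail p)
      - (1 / 2) * pd 0 (rDeriv h i j) p - (1 / 2) * (meanCurv h p * rDeriv h i j p)
      + (1 / 4) * (∑ l, rDeriv h j l p * shape h l i p + ∑ l, rDeriv h i l p * shape h l j p)
      - (m' (p 0) / 2 + m (p 0) / 2 * meanCurv h p + (n - 1) / 4 * m (p 0) ^ 2)
        * component h i j p
      - (n - 1) / 4 * m (p 0) * rDeriv h i j p := by
  have hp' := openCollar_subset hp
  have h1 : pd 0 (christoffel (warped c h) 0 i.succ j.succ) p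
      = -(1 / 2) * (pd 0 (rDeriv h i j) p
        + (m (p 0) * rDeriv h i j p + component h i j p * m' (p 0))) := by
    have hmd : DifferentiableAt ℝ (fun q : Fin (n + 1) → ℝ => m (q 0)) p :=
      (hm _ hp.1).differentiableAt.comp p (differentiableAt_apply 0 p)
    have hcd := hh.differentiableAt_component hp i j
    rw [pd_congr (g := fun q => -(1 / 2) * (rDeriv h i j q + m (q 0) * component h i j q)),
      pd_const_mul, pd_add (hh.differentiableAt_rDeriv hp i j) (hmd.fun_mul hcd), pd_mul hmd hcd,
      pd_comp_coord (hm _ hp.1), if_pos rfl]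
    · rfl
    filter_upwards [hh.openCollar_mem_nhds hp] with q hq
    rw [hh.christoffel_warped_zero_succ_succ hc0 hc hq]
    ring
  have h2 : ∀ j : Fin n, pd j.succ (christoffel (warped c h) 0 i.succ 0) p = 0 := fun j => by
    rw [pd_congr (g := fun _ => 0), pd_const]
    filter_upwards [hh.openCollar_mem_nhds hp] with q hq
    exact hh.christoffel_warped_zero_succ_zero hc0 hc hq i
  have h3 : ∀ a k i j : Fin n, pd a.succ (christoffel (warped c h) k.succ i.succ j.succ) p
      = pd a (christoffel (h (p 0)) k i j) (Fin.tail p) := fun a k i j => by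
    have hd : DifferentiableAt ℝ
        (fun q : Fin (n + 1) → ℝ => christoffel (h (q 0)) k i j (Fin.tail q)) p :=
      (differentiableOn_of_contDiffOn_two
        (hh.contDiffOn_christoffel_slice k i j)).differentiableAt (collar_mem_nhds hh.isOpen hp)
    rw [pd_congr (g := fun q => christoffel (h (q 0)) k i j (Fin.tail q))]
    · obtain ⟨r, x, rfl⟩ : ∃ r x, p = Fin.cons r x := ⟨_, _, (Fin.cons_self_tail p).symm⟩
      rw [pd_succ_cons hd]
      simp
    filter_upwards [hh.openCollar_mem_nhds hp] with q hq
    exact hh.christoffel_warped_succ_succ_succ hc0 hc hq k i j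
  -- This is (h' + m h) h⁻¹ (h' + m h); the two cross terms both equal m h', whence the factor 2.
  have h4 : ∀ i j : Fin n, ∑ l, (rDeriv h i l p + m (p 0) * component h i l p) *
        (shape h l j p + m (p 0) * if l = j then 1 else 0)
      = ∑ l, rDeriv h i l p * shape h l j p + 2 * m (p 0) * rDeriv h i j p
        + m (p 0) ^ 2 * component h i j p := by
    intro i j
    have : ∀ l, (rDeriv h i l p + m (p 0) * component h i l p) *
        (shape h l j p + m (p 0) * if l = j then 1 else 0)
      = rDeriv h i l p * shape h l j p + m (p 0) * (component h i l p * shape h l j p)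
        + (if l = j then m (p 0) * rDeriv h i l p + m (p 0) ^ 2 * component h i l p else 0) := by
      intro l
      split_ifs <;> ring
    simp only [this, Finset.sum_add_distrib, ← Finset.mul_sum, hh.sum_component_mul_shape hp',
      Finset.sum_ite_eq', Finset.mem_univ, if_true]
    ring
  have h5 : ∀ i j : Fin n, ∑ l, -(rDeriv h i l p + m (p 0) * component h i l p) / 2 *
        ((shape h l j p + m (p 0) * if l = j then 1 else 0) / 2)
      = -(1 / 4) * (∑ l, rDeriv h i l p * shape h l j p + 2 * m (p 0) * rDeriv h i j p
        + m (p 0) ^ 2 * component h i j p) := by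
    intro i j
    rw [← h4, Finset.mul_sum]
    exact Finset.sum_congr rfl fun l _ => by ring
  have h6 : ∑ l, ((shape h l j p + m (p 0) * if l = j then 1 else 0) / 2) *
        (-(rDeriv h i l p + m (p 0) * component h i l p) / 2)
      = -(1 / 4) * (∑ l, rDeriv h i l p * shape h l j p + 2 * m (p 0) * rDeriv h i j p
        + m (p 0) ^ 2 * component h i j p) := by
    rw [← h5]
    exact Finset.sum_congr rfl fun l _ => by ring
  have h7 : rDeriv h j i p = rDeriv h i j p := hh.rDeriv_symm hp j i
  have h8 : component h j i p = component h i j p := hh.symm _ hp'.1 _ hp'.2 j i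
  rw [ricci, Fin.sum_univ_succ]
  simp only [Fin.sum_univ_succ, h1, h2, h3, hh.christoffel_warped_zero_zero_zero hc0 hc hp,
    hh.christoffel_warped_zero_zero_succ hc0 hc hp, hh.christoffel_warped_zero_succ_zero hc0 hc hp,
    hh.christoffel_warped_zero_succ_succ hc0 hc hp, hh.christoffel_warped_succ_succ_succ hc0 hc hp,
    hh.christoffel_warped_succ_succ_zero hc0 hc hp, mul_zero, zero_mul, sub_zero,
    add_zero, zero_add, Finset.sum_const_zero, if_true, meanCurv, Finset.sum_add_distrib,
    Finset.sum_sub_distrib, mul_one,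
    ← Finset.sum_mul, ← Finset.sum_div, h5, h6, h7, h8, ricci,
    Finset.sum_const, Finset.card_univ, Fintype.card_fin, nsmul_eq_mul]
  ring

end IsRegularFamily

end WarpedRicci

/-! ### Ric(g) + n g for the Poincaré metric, and the Laplacian of dr² + h_r -/

section EinsteinDefect

variable {n : ℕ} {ε : ℝ} {U : Set (Fin n → ℝ)} {h : ℝ → (Fin n → ℝ) → Matrix (Fin n) (Fin n) ℝ}

theorem poincareMetric_eq_warped : poincareMetric h = warped (fun r => (r ^ 2)⁻¹) h := rfl

theorem cylMetric_eq_warped : cylMetric h = warped (fun _ => 1) h := by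
  funext p
  simp [warped]

/-- The squared norm of `∂_r h_r`. -/
noncomputable def rDerivNormSq (h : ℝ → (Fin n → ℝ) → Matrix (Fin n) (Fin n) ℝ)
    (p : Fin (n + 1) → ℝ) : ℝ :=
  ∑ i, ∑ j, shape h i j p * shape h j i p

namespace IsRegularFamily

variable (hh : IsRegularFamily ε U h)
include hh

theorem ricci_cylMetric_zero_zero {p : Fin (n + 1) → ℝ} (hp : p ∈ openCollar ε U) :
    ricci (cylMetric h) 0 0 p = -pd 0 (meanCurv h) p - (1 / 4) * rDerivNormSq h p := by
  rw [cylMetric_eq_warped, hh.ricci_warped_zero_zero (m := fun _ => 0) (m' := fun _ => 0)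
    (fun _ _ => one_ne_zero) (fun r _ => by simpa using hasDerivAt_const r (1 : ℝ))
    (fun r _ => hasDerivAt_const r 0) hp, rDerivNormSq]
  ring

theorem ricci_cylMetric_succ_succ {p : Fin (n + 1) → ℝ} (hp : p ∈ openCollar ε U) (i j : Fin n) :
    ricci (cylMetric h) i.succ j.succ p = ricci (h (p 0)) i j (Fin.tail p)
      - (1 / 2) * pd 0 (rDeriv h i j) p - (1 / 2) * (meanCurv h p * rDeriv h i j p)
      + (1 / 4) * (∑ l, rDeriv h j l p * shape h l i p + ∑ l, rDeriv h i l p * shape h l j p) := by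
  rw [cylMetric_eq_warped, hh.ricci_warped_succ_succ (m := fun _ => 0) (m' := fun _ => 0)
    (fun _ _ => one_ne_zero) (fun r _ => by simpa using hasDerivAt_const r (1 : ℝ))
    (fun r _ => hasDerivAt_const r 0) hp]
  ring

omit hh in
theorem hasDerivAt_inv_sq {r : ℝ} (hr : r ∈ Ioo 0 ε) :
    HasDerivAt (fun r : ℝ => (r ^ 2)⁻¹) (-2 / r * (r ^ 2)⁻¹) r := by
  have h0 := hr.1.ne'
  refine ((hasDerivAt_pow 2 r).fun_inv (pow_ne_zero 2 h0)).congr_deriv ?_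
  field_simp
  norm_num
  ring

omit hh in
theorem hasDerivAt_neg_two_div {r : ℝ} (hr : r ∈ Ioo 0 ε) :
    HasDerivAt (fun r : ℝ => -2 / r) (2 / r ^ 2) r := by
  have h0 := hr.1.ne'
  refine ((hasDerivAt_const r (-2 : ℝ)).fun_div (hasDerivAt_id' r) h0).congr_deriv ?_
  field_simp
  norm_num

/-- With m' = 2/r² the Ricci term -n m'/2 cancels n g_{00} = n/r², so only a simple pole in r
remains. -/
theorem einsteinDefect_zero_zero {r : ℝ} {x : Fin n → ℝ} (hr : r ∈ Ioo 0 ε) (hx : x ∈ U) :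
    einsteinDefect h r x 0 0 = -pd 0 (meanCurv h) (Fin.cons r x)
      - (1 / 4) * rDerivNormSq h (Fin.cons r x) + meanCurv h (Fin.cons r x) / r := by
  have hp := cons_mem_openCollar (n := n) hr hx
  have h0 := hr.1.ne'
  rw [einsteinDefect, poincareMetric_eq_warped, hh.ricci_warped_zero_zero
    (fun r hr => inv_ne_zero (pow_ne_zero 2 hr.1.ne')) (fun _ hr => hasDerivAt_inv_sq hr)
    (fun _ hr => hasDerivAt_neg_two_div hr) hp, rDerivNormSq, warped, Matrix.smul_apply,
    cylMetric_zero_zero]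
  simp only [Fin.cons_zero, smul_eq_mul, mul_one]
  field_simp
  ring

/-- The double pole cancels again, since m'/2 + (n-1)m²/4 = n/r². -/
theorem einsteinDefect_succ_succ {r : ℝ} {x : Fin n → ℝ} (hr : r ∈ Ioo 0 ε) (hx : x ∈ U)
    (i j : Fin n) :
    einsteinDefect h r x i.succ j.succ = ricci (cylMetric h) i.succ j.succ (Fin.cons r x)
      + meanCurv h (Fin.cons r x) / r * h r x i j
      + ((n : ℝ) - 1) / 2 * (rDeriv h i j (Fin.cons r x) / r) := by
  have hp := cons_mem_openCollar (n := n) hr hx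
  have h0 := hr.1.ne'
  rw [einsteinDefect, poincareMetric_eq_warped, hh.ricci_warped_succ_succ
    (fun r hr => inv_ne_zero (pow_ne_zero 2 hr.1.ne')) (fun _ hr => hasDerivAt_inv_sq hr)
    (fun _ hr => hasDerivAt_neg_two_div hr) hp, hh.ricci_cylMetric_succ_succ hp, warped,
    Matrix.smul_apply, cylMetric_succ_succ]
  simp only [Fin.cons_zero, Fin.tail_cons, smul_eq_mul, component]
  field_simp
  ring

theorem sum_inv_mul_rDeriv {p : Fin (n + 1) → ℝ} (hp : p ∈ openCollar ε U) :
    ∑ i, ∑ j, (h (p 0) (Fin.tail p))⁻¹ i j * rDeriv h i j p = 2 * meanCurv h p := by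
  simp only [meanCurv, shape]
  rw [← mul_assoc]
  norm_num
  exact Finset.sum_congr rfl fun i _ => Finset.sum_congr rfl fun j _ => by
    rw [hh.rDeriv_symm hp i j]

theorem sum_inv_mul_self {p : Fin (n + 1) → ℝ} (hp : p ∈ collar ε U) :
    ∑ i, ∑ j, (h (p 0) (Fin.tail p))⁻¹ i j * h (p 0) (Fin.tail p) i j = n := by
  have : ∀ i, ∑ j, (h (p 0) (Fin.tail p))⁻¹ i j * h (p 0) (Fin.tail p) i j = 1 := fun i => by
    have := hh.sum_inv_mul_component hp i i
    rwa [if_pos rfl] at this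
  simp [this]

/-- The trace of `Ric(g) + n g` with respect to `dr^2 + h_r`. -/
theorem trace_einsteinDefect {r : ℝ} {x : Fin n → ℝ} (hr : r ∈ Ioo 0 ε) (hx : x ∈ U) :
    einsteinDefect h r x 0 0
        + ∑ i : Fin n, ∑ j : Fin n, (h r x)⁻¹ i j * einsteinDefect h r x i.succ j.succ
      = scalarCurv (cylMetric h) (Fin.cons r x) + 2 * n * (meanCurv h (Fin.cons r x) / r) := by
  have hp := cons_mem_openCollar (n := n) hr hx
  have hp' := openCollar_subset hp
  have h1 := hh.sum_inv_mul_rDeriv hp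
  have h2 := hh.sum_inv_mul_self hp'
  simp only [Fin.cons_zero, Fin.tail_cons] at h1 h2
  have e : ∀ i j : Fin n, (h r x)⁻¹ i j * einsteinDefect h r x i.succ j.succ
      = (h r x)⁻¹ i j * ricci (cylMetric h) i.succ j.succ (Fin.cons r x)
        + meanCurv h (Fin.cons r x) / r * ((h r x)⁻¹ i j * h r x i j)
        + ((n : ℝ) - 1) / 2 / r * ((h r x)⁻¹ i j * rDeriv h i j (Fin.cons r x)) := fun i j => by
    rw [hh.einsteinDefect_succ_succ hr hx]
    ring
  simp only [e, Finset.sum_add_distrib, ← Finset.mul_sum, h1, h2]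
  rw [scalarCurv, cylMetric_inv (hh.det_ne _ hp'.1 _ hp'.2), Fin.sum_univ_succ]
  simp only [Fin.sum_univ_succ, cylMetric_zero_zero, cylMetric_zero_succ, cylMetric_succ_zero,
    cylMetric_succ_succ, Fin.cons_zero, Fin.tail_cons, zero_mul, Finset.sum_const_zero, zero_add,
    add_zero, one_mul]
  -- The coefficient 2n of L/r is the sum of 1 from the dr dr component, n from the trace of h and n
  -- - 1 from the trace of h'.
  rw [hh.einsteinDefect_zero_zero hr hx, hh.ricci_cylMetric_zero_zero hp]
  ring

/-- The first-order term in r comes from Γ^0_{ij} = -h'_{ij}/2; mixed second derivatives are absent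
because the metric is block diagonal. -/
theorem laplacian_cylMetric {u : (Fin (n + 1) → ℝ) → ℝ}
    (hu : ContDiffOn ℝ (2 : ℕ) u (openCollar ε U)) {r : ℝ} {x : Fin n → ℝ} (hr : r ∈ Ioo 0 ε)
    (hx : x ∈ U) :
    laplacian (cylMetric h) u (Fin.cons r x) = pd 0 (pd 0 u) (Fin.cons r x)
      + meanCurv h (Fin.cons r x) * pd 0 u (Fin.cons r x)
      + laplacian (h r) (fun y => u (Fin.cons r y)) x := by
  have hp := cons_mem_openCollar (n := n) hr hx
  have hp' := openCollar_subset hp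
  have hO := isOpen_openCollar (ε := ε) hh.isOpen
  have hud : ∀ y ∈ U, DifferentiableAt ℝ u (Fin.cons r y) := fun y hy =>
    (differentiableOn_of_contDiffOn_two hu).differentiableAt
      (hO.mem_nhds (cons_mem_openCollar hr hy))
  have hpd : ∀ a, DifferentiableAt ℝ (pd a u) (Fin.cons r x) := fun a => by
    have h1 : ContDiffOn ℝ (1 : ℕ) (pd a u) (openCollar ε U) :=
      (contDiffOn_pdWithin (i := a) hO.uniqueDiffOn hu).congr fun p hp =>
        (pdWithin_of_mem_nhds (hO.mem_nhds hp)).symm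
    exact (h1.differentiableOn (by norm_num)).differentiableAt (hO.mem_nhds hp)
  have e1 : ∀ j : Fin n, ∀ y ∈ U,
      pd j.succ u (Fin.cons r y) = pd j (fun z => u (Fin.cons r z)) y :=
    fun j y hy => pd_succ_cons (hud y hy) j
  have e2 : ∀ i j : Fin n, pd i.succ (pd j.succ u) (Fin.cons r x)
      = pd i (pd j fun z => u (Fin.cons r z)) x := fun i j => by
    rw [pd_succ_cons (hpd j.succ)]
    refine pd_congr ?_
    filter_upwards [hh.isOpen.mem_nhds hx] with y hy using e1 j y hy
  have c1 : ∀ r ∈ Ioo 0 ε, (fun _ : ℝ => (1 : ℝ)) r ≠ 0 := fun _ _ => one_ne_zero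
  have c2 : ∀ r ∈ Ioo 0 ε, HasDerivAt (fun _ : ℝ => (1 : ℝ)) ((fun _ => (0 : ℝ)) r * 1) r :=
    fun r _ => by simpa using hasDerivAt_const r (1 : ℝ)
  have h1 := hh.sum_inv_mul_rDeriv hp
  have h2 : meanCurv h (Fin.cons r x) = (1 / 2) * ∑ i, ∑ j,
      (h r x)⁻¹ i j * rDeriv h i j (Fin.cons r x) := by
    simp only [Fin.cons_zero, Fin.tail_cons] at h1
    rw [h1]
    ring
  have hinv := cylMetric_inv (hh.det_ne _ hp'.1 _ hp'.2)
  rw [laplacian, divergence, hinv, Fin.sum_univ_succ]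
  simp only [Fin.sum_univ_succ, cylMetric_zero_zero, cylMetric_zero_succ, cylMetric_succ_zero,
    cylMetric_succ_succ, zero_mul, Finset.sum_const_zero, zero_add, add_zero, one_mul]
  rw [cylMetric_eq_warped]
  simp only [hh.christoffel_warped_zero_zero_zero c1 c2 hp,
    hh.christoffel_warped_succ_zero_zero c1 c2 hp, hh.christoffel_warped_zero_succ_succ c1 c2 hp,
    hh.christoffel_warped_succ_succ_succ c1 c2 hp, e1 _ x hx, e2, Fin.cons_zero, Fin.tail_cons,
    laplacian, divergence, zero_mul, zero_div, Finset.sum_const_zero, add_zero, sub_zero]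
  rw [h2, add_assoc]
  congr 1
  rw [mul_assoc, Finset.sum_mul, Finset.mul_sum, ← Finset.sum_add_distrib]
  refine Finset.sum_congr rfl fun i _ => ?_
  rw [Finset.sum_mul, Finset.mul_sum, ← Finset.sum_add_distrib]
  exact Finset.sum_congr rfl fun j _ => by ring

end IsRegularFamily

end EinsteinDefect

/-! ### Leading terms of h_r forced by the Einstein equation -/

section Asymptotics

variable {n : ℕ} {ε : ℝ} {U : Set (Fin n → ℝ)} {h : ℝ → (Fin n → ℝ) → Matrix (Fin n) (Fin n) ℝ}

/-- At `x`, `Ric(g) + n g` is `O(r^2)`, and its trace and its `dr dr` component are `o(r^2)`. -/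
structure IsAsymptoticallyEinstein (h : ℝ → (Fin n → ℝ) → Matrix (Fin n) (Fin n) ℝ)
    (x : Fin n → ℝ) : Prop where
  tangential : ∀ i j : Fin n,
    (fun r => einsteinDefect h r x i.succ j.succ) =O[𝓝[>] 0] fun r : ℝ => r ^ 2
  normal : (fun r => einsteinDefect h r x 0 0) =o[𝓝[>] 0] fun r : ℝ => r ^ 2
  trace : (fun r => ∑ i : Fin n, ∑ j : Fin n,
      (h 0 x)⁻¹ i j * einsteinDefect h r x i.succ j.succ) =o[𝓝[>] 0] fun r : ℝ => r ^ 2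

theorem inv_matrix_symm {κ : Type*} [Fintype κ] [DecidableEq κ] {A : Matrix κ κ ℝ}
    (hA : ∀ i j, A i j = A j i) (i j : κ) : A⁻¹ i j = A⁻¹ j i := by
  have h : A.transpose = A := Matrix.ext fun i j => hA j i
  have := congrFun (congrFun (Matrix.transpose_nonsing_inv A) i) j
  rw [h, Matrix.transpose_apply] at this
  exact this.symm

namespace IsRegularFamily

variable (hh : IsRegularFamily ε U h)
include hh

theorem zero_mem : (0 : ℝ) ∈ Ico 0 ε := ⟨le_rfl, hh.pos⟩

theorem contDiffOn_slice {x : Fin n → ℝ} (hx : x ∈ U) (i j : Fin n) :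
    ContDiffOn ℝ (3 : ℕ) (fun r => h r x i j) (Ico 0 ε) := by
  simpa using contDiffOn_cons_left (hh.contDiffOn i j) hx

theorem rDeriv_eq_deriv {x : Fin n → ℝ} (hx : x ∈ U) (i j : Fin n) {r : ℝ} (hr : r ∈ Ioo 0 ε) :
    rDeriv h i j (Fin.cons r x) = deriv (fun r => h r x i j) r := by
  have := hasDerivAt_cons (hh.differentiableAt_component (cons_mem_openCollar hr hx) i j)
  simp only [component, Fin.cons_zero, Fin.tail_cons] at this
  exact this.deriv.symm

theorem pd_rDeriv_eq_deriv {x : Fin n → ℝ} (hx : x ∈ U) (i j : Fin n) {r : ℝ}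
    (hr : r ∈ Ioo 0 ε) :
    pd 0 (rDeriv h i j) (Fin.cons r x) = deriv (deriv fun r => h r x i j) r := by
  have := hasDerivAt_cons (hh.differentiableAt_rDeriv (cons_mem_openCollar hr hx) i j)
  rw [← this.deriv]
  refine EventuallyEq.deriv_eq ?_
  filter_upwards [Ioo_mem_nhds hr.1 hr.2] with s hs using hh.rDeriv_eq_deriv hx i j hs

theorem tendsto_inv {x : Fin n → ℝ} (hx : x ∈ U) (i j : Fin n) :
    Tendsto (fun r => (h r x)⁻¹ i j) (𝓝[>] 0) (𝓝 ((h 0 x)⁻¹ i j)) := by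
  simpa using tendsto_cons_of_continuousOn hh.pos (hh.contDiffOn_inv i j).continuousOn hx

theorem tendsto_slice {x : Fin n → ℝ} (hx : x ∈ U) (i j : Fin n) :
    Tendsto (fun r => h r x i j) (𝓝[>] 0) (𝓝 (h 0 x i j)) :=
  tendsto_of_contDiffOn_Ico hh.pos (hh.contDiffOn_slice hx i j)

theorem tendsto_ricci {x : Fin n → ℝ} (hx : x ∈ U) (i j : Fin n) :
    Tendsto (fun r => ricci (h r) i j x) (𝓝[>] 0) (𝓝 (ricci (h 0) i j x)) := by
  simpa using tendsto_cons_of_continuousOn hh.pos (hh.continuousOn_ricci_slice i j) hx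

theorem tendsto_christoffel {x : Fin n → ℝ} (hx : x ∈ U) (k i j : Fin n) :
    Tendsto (fun r => christoffel (h r) k i j x) (𝓝[>] 0) (𝓝 (christoffel (h 0) k i j x)) := by
  simpa using tendsto_cons_of_continuousOn hh.pos
    (hh.contDiffOn_christoffel_slice k i j).continuousOn hx

theorem eventually_mem_openCollar {x : Fin n → ℝ} (hx : x ∈ U) :
    ∀ᶠ r in 𝓝[>] (0 : ℝ), r ∈ Ioo 0 ε ∧ (Fin.cons r x : Fin (n + 1) → ℝ) ∈ openCollar ε U := by
  filter_upwards [Ioo_mem_nhdsGT_zero hh.pos] with r hr using ⟨hr, cons_mem_openCollar hr hx⟩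

/-- The limits of `∂_r h` and `∂_r^2 h` at a boundary point, as far as the Einstein equation
does not determine them. -/
theorem exists_tendsto_rDeriv {x : Fin n → ℝ} (hx : x ∈ U) : ∃ D DD : Fin n → Fin n → ℝ,
    (∀ i j, Tendsto (fun r => rDeriv h i j (Fin.cons r x)) (𝓝[>] 0) (𝓝 (D i j))) ∧
    (∀ i j, Tendsto (fun r => pd 0 (rDeriv h i j) (Fin.cons r x)) (𝓝[>] 0) (𝓝 (DD i j))) ∧
    ∀ i j, D i j = 0 →
      Tendsto (fun r => rDeriv h i j (Fin.cons r x) / r) (𝓝[>] 0) (𝓝 (DD i j)) := by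
  have hI := Ioo_mem_nhdsGT_zero hh.pos
  refine ⟨fun i j => derivWithin (fun r => h r x i j) (Ico 0 ε) 0,
    fun i j => derivWithin (derivWithin (fun r => h r x i j) (Ico 0 ε)) (Ico 0 ε) 0,
    fun i j => ?_, fun i j => ?_, fun i j h0 => ?_⟩
  · refine (tendsto_deriv_of_contDiffOn_Ico (m := 2) hh.pos (hh.contDiffOn_slice hx i j)).congr' ?_
    filter_upwards [hI] with r hr using (hh.rDeriv_eq_deriv hx i j hr).symm
  · refine (tendsto_deriv_deriv_of_contDiffOn_Ico (m := 1) hh.pos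
      (hh.contDiffOn_slice hx i j)).congr' ?_
    filter_upwards [hI] with r hr using (hh.pd_rDeriv_eq_deriv hx i j hr).symm
  · refine (tendsto_deriv_div_of_contDiffOn_Ico (m := 1) hh.pos
      (hh.contDiffOn_slice hx i j) h0).congr' ?_
    filter_upwards [hI] with r hr
    rw [hh.rDeriv_eq_deriv hx i j hr]

/-- The weight ρ allows limits of quantities divided by r (ρ = 1/r) as well as plain ones (ρ = 1).
-/
theorem tendsto_shape_mul {x : Fin n → ℝ} (hx : x ∈ U) {ρ : ℝ → ℝ} {D : Fin n → Fin n → ℝ}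
    (hD : ∀ i j, Tendsto (fun r => rDeriv h i j (Fin.cons r x) * ρ r) (𝓝[>] 0) (𝓝 (D i j)))
    (i j : Fin n) : Tendsto (fun r => shape h i j (Fin.cons r x) * ρ r) (𝓝[>] 0)
      (𝓝 (∑ l, (h 0 x)⁻¹ i l * D l j)) := by
  refine (tendsto_finsetSum _ fun l _ => (hh.tendsto_inv hx i l).mul (hD l j)).congr fun r => ?_
  simp [shape, Finset.sum_mul, mul_assoc]

theorem tendsto_meanCurv_mul {x : Fin n → ℝ} (hx : x ∈ U) {ρ : ℝ → ℝ} {D : Fin n → Fin n → ℝ}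
    (hD : ∀ i j, Tendsto (fun r => rDeriv h i j (Fin.cons r x) * ρ r) (𝓝[>] 0) (𝓝 (D i j))) :
    Tendsto (fun r => meanCurv h (Fin.cons r x) * ρ r) (𝓝[>] 0)
      (𝓝 ((1 / 2) * ∑ i, ∑ j, (h 0 x)⁻¹ i j * D i j)) := by
  refine ((tendsto_finsetSum Finset.univ fun i _ => tendsto_finsetSum Finset.univ fun j _ =>
    (hh.tendsto_inv hx i j).mul (hD i j)).const_mul (1 / 2)).congr' ?_
  filter_upwards [hh.eventually_mem_openCollar hx] with r hr
  have := hh.sum_inv_mul_rDeriv hr.2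
  simp only [Fin.cons_zero, Fin.tail_cons] at this
  simp only [← mul_assoc, ← Finset.sum_mul, this]
  ring

/-- Needed twice: before D = 0 is known, only to have a finite limit; afterwards for its value, when
all terms quadratic in h' drop out. -/
theorem exists_tendsto_ricci_cylMetric {x : Fin n → ℝ} (hx : x ∈ U) {D DD : Fin n → Fin n → ℝ}
    (hD : ∀ i j, Tendsto (fun r => rDeriv h i j (Fin.cons r x)) (𝓝[>] 0) (𝓝 (D i j)))
    (hDD : ∀ i j, Tendsto (fun r => pd 0 (rDeriv h i j) (Fin.cons r x)) (𝓝[>] 0) (𝓝 (DD i j)))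
    (i j : Fin n) : ∃ R, Tendsto (fun r => ricci (cylMetric h) i.succ j.succ (Fin.cons r x))
      (𝓝[>] 0) (𝓝 R) ∧ ((∀ i j, D i j = 0) → R = ricci (h 0) i j x - (1 / 2) * DD i j) := by
  have hD' : ∀ i j, Tendsto (fun r => rDeriv h i j (Fin.cons r x) * 1) (𝓝[>] 0) (𝓝 (D i j)) := by
    simpa using hD
  have hS := hh.tendsto_shape_mul hx hD'
  have hL := hh.tendsto_meanCurv_mul hx hD'
  simp only [mul_one] at hS hL
  refine ⟨_, ((((hh.tendsto_ricci hx i j).sub ((hDD i j).const_mul (1 / 2))).sub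
    ((hL.mul (hD i j)).const_mul (1 / 2))).add
    (((tendsto_finsetSum Finset.univ fun l _ => (hD j l).mul (hS l i)).add
      (tendsto_finsetSum Finset.univ fun l _ => (hD i l).mul (hS l j))).const_mul
      (1 / 4))).congr' ?_, fun h0 => by simp [h0]⟩
  filter_upwards [hh.eventually_mem_openCollar hx] with r hr
  rw [hh.ricci_cylMetric_succ_succ hr.2]
  simp

/-- The Einstein equation forces `∂_r h = 0` and `∂_r^2 h = -2 P` at the boundary. -/
theorem tendsto_rDeriv_div (hn : 3 ≤ n) {x : Fin n → ℝ} (hx : x ∈ U)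
    (hE : IsAsymptoticallyEinstein h x) :
    (∀ i j, Tendsto (fun r => rDeriv h i j (Fin.cons r x)) (𝓝[>] 0) (𝓝 0)) ∧
    (∀ i j, Tendsto (fun r => rDeriv h i j (Fin.cons r x) / r) (𝓝[>] 0)
      (𝓝 (-2 * schouten (h 0) i j x))) ∧
    Tendsto (fun r => meanCurv h (Fin.cons r x) / r) (𝓝[>] 0) (𝓝 (-J (h 0) x)) := by
  have hn' : (3 : ℝ) ≤ n := by exact_mod_cast hn
  obtain ⟨D, DD, hD, hDD, hdiv⟩ := hh.exists_tendsto_rDeriv hx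
  have hE0 : ∀ i j : Fin n,
      Tendsto (fun r => einsteinDefect h r x i.succ j.succ) (𝓝[>] 0) (𝓝 0) := fun i j =>
    (hE.tangential i j).trans_tendsto (by simpa using tendsto_id_nhdsGT_zero.pow 2)
  have hself := hh.sum_inv_mul_self (cons_mem_collar hh.zero_mem hx)
  simp only [Fin.cons_zero, Fin.tail_cons] at hself
  have hD0 : ∀ i j, D i j = 0 := by
    have hD' : ∀ i j, Tendsto (fun r => rDeriv h i j (Fin.cons r x) * 1) (𝓝[>] 0)
        (𝓝 (D i j)) := by simpa using hD
    have hL := hh.tendsto_meanCurv_mul hx hD'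
    simp only [mul_one] at hL
    set L := (1 / 2) * ∑ i, ∑ j, (h 0 x)⁻¹ i j * D i j with hLdef
    -- The limit of r times the tangential Einstein defect. Its trace is (2n - 1) L = 0, so L and
    -- then D vanish.
    have key : ∀ i j, L * h 0 x i j + ((n : ℝ) - 1) / 2 * D i j = 0 := fun i j => by
      obtain ⟨R, hR, -⟩ := hh.exists_tendsto_ricci_cylMetric hx hD hDD i j
      have h1 := tendsto_id_nhdsGT_zero.mul (hE0 i j)
      have h2 := ((tendsto_id_nhdsGT_zero.mul hR).add (hL.mul (hh.tendsto_slice hx i j))).add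
        ((hD i j).const_mul (((n : ℝ) - 1) / 2))
      have h3 := tendsto_nhds_unique h2 (h1.congr' (by
        filter_upwards [Ioo_mem_nhdsGT_zero hh.pos] with r hr
        have := hr.1.ne'
        rw [hh.einsteinDefect_succ_succ hr hx]
        field_simp))
      linarith
    have hL0 : L = 0 := by
      have h1 : ∑ i, ∑ j, (h 0 x)⁻¹ i j * (L * h 0 x i j + ((n : ℝ) - 1) / 2 * D i j) = 0 := by
        simp [key]
      have h2 : ∑ i, ∑ j, (h 0 x)⁻¹ i j * (L * h 0 x i j + ((n : ℝ) - 1) / 2 * D i j)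
          = L * ∑ i, ∑ j, (h 0 x)⁻¹ i j * h 0 x i j
            + ((n : ℝ) - 1) / 2 * ∑ i, ∑ j, (h 0 x)⁻¹ i j * D i j := by
        simp only [Finset.mul_sum, ← Finset.sum_add_distrib]
        exact Finset.sum_congr rfl fun i _ => Finset.sum_congr rfl fun j _ => by ring
      have h3 : ∑ i, ∑ j, (h 0 x)⁻¹ i j * D i j = 2 * L := by rw [hLdef]; ring
      rw [h1, hself, h3] at h2
      have : L * (2 * n - 1) = 0 := by linarith
      exact (mul_eq_zero.1 this).resolve_right (by linarith)
    intro i j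
    have := key i j
    rw [hL0, zero_mul, zero_add] at this
    exact (mul_eq_zero.1 this).resolve_left (by linarith)
  have hdiv' := fun i j => hdiv i j (hD0 i j)
  have hT : Tendsto (fun r => meanCurv h (Fin.cons r x) / r) (𝓝[>] 0)
      (𝓝 ((1 / 2) * ∑ i, ∑ j, (h 0 x)⁻¹ i j * DD i j)) := by
    simpa only [div_eq_mul_inv] using hh.tendsto_meanCurv_mul hx (ρ := fun r => r⁻¹)
      (by simpa only [div_eq_mul_inv] using hdiv')
  set T := (1 / 2) * ∑ i, ∑ j, (h 0 x)⁻¹ i j * DD i j with hTdef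
  -- The limit of the defect itself. The coefficient of DD is (n-1)/2 from h'/r minus 1/2 from the
  -- Ricci tensor of dr² + h_r.
  have key : ∀ i j, ricci (h 0) i j x + T * h 0 x i j + ((n : ℝ) - 2) / 2 * DD i j = 0 :=
    fun i j => by
      obtain ⟨R, hR, hR0⟩ := hh.exists_tendsto_ricci_cylMetric hx hD hDD i j
      have h2 := (hR.add (hT.mul (hh.tendsto_slice hx i j))).add
        ((hdiv' i j).const_mul (((n : ℝ) - 1) / 2))
      have h3 := tendsto_nhds_unique h2 ((hE0 i j).congr' (by
        filter_upwards [Ioo_mem_nhdsGT_zero hh.pos] with r hr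
        rw [hh.einsteinDefect_succ_succ hr hx]))
      rw [hR0 hD0] at h3
      linarith
  -- The trace of `key` reads τ + nT + (n-2)T = 0, so T = -J, and solving `key` for DD gives -2P.
  have hτ : scalarCurv (h 0) x = -(2 * (n - 1)) * T := by
    have h1 : ∑ i, ∑ j, (h 0 x)⁻¹ i j *
        (ricci (h 0) i j x + T * h 0 x i j + ((n : ℝ) - 2) / 2 * DD i j) = 0 := by
      simp [key]
    have h2 : ∑ i, ∑ j, (h 0 x)⁻¹ i j *
        (ricci (h 0) i j x + T * h 0 x i j + ((n : ℝ) - 2) / 2 * DD i j)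
        = scalarCurv (h 0) x + T * ∑ i, ∑ j, (h 0 x)⁻¹ i j * h 0 x i j
          + ((n : ℝ) - 2) / 2 * ∑ i, ∑ j, (h 0 x)⁻¹ i j * DD i j := by
      simp only [scalarCurv, Finset.mul_sum, ← Finset.sum_add_distrib]
      exact Finset.sum_congr rfl fun i _ => Finset.sum_congr rfl fun j _ => by ring
    have h3 : ∑ i, ∑ j, (h 0 x)⁻¹ i j * DD i j = 2 * T := by rw [hTdef]; ring
    rw [h1, hself, h3] at h2
    linarith
  have hn1 : (n : ℝ) - 1 ≠ 0 := by linarith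
  have hn2 : (n : ℝ) - 2 ≠ 0 := by linarith
  have hTJ : T = -J (h 0) x := by
    rw [J, hτ, Fintype.card_fin]
    field_simp
  refine ⟨fun i j => by simpa [hD0] using hD i j, fun i j => ?_, hTJ ▸ hT⟩
  have : DD i j = -2 * schouten (h 0) i j x := by
    have h1 := key i j
    rw [schouten, hτ, Fintype.card_fin]
    field_simp
    linarith
  exact this ▸ hdiv' i j

/-- Each factor h⁻¹h'/r tends to -2P with an index raised. -/
theorem tendsto_rDerivNormSq_div (hn : 3 ≤ n) {x : Fin n → ℝ} (hx : x ∈ U)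
    (hE : IsAsymptoticallyEinstein h x) :
    Tendsto (fun r => rDerivNormSq h (Fin.cons r x) / r ^ 2) (𝓝[>] 0)
      (𝓝 (4 * schoutenNormSq (h 0) x)) := by
  obtain ⟨-, hP, -⟩ := hh.tendsto_rDeriv_div hn hx hE
  have hS := hh.tendsto_shape_mul hx (ρ := fun r => r⁻¹)
    (by simpa only [div_eq_mul_inv] using hP)
  -- The symmetry of P is inherited from that of h' through uniqueness of limits, with no
  -- computation in the Ricci tensor.
  have hPs : ∀ i j, schouten (h 0) i j x = schouten (h 0) j i x := fun i j => by
    have := tendsto_nhds_unique (hP i j) ((hP j i).congr' (by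
      filter_upwards [hh.eventually_mem_openCollar hx] with r hr
      rw [hh.rDeriv_symm hr.2]))
    linarith
  have hinv := inv_matrix_symm (hh.symm 0 hh.zero_mem x hx)
  have e : 4 * schoutenNormSq (h 0) x = ∑ i, ∑ j,
      (∑ l, (h 0 x)⁻¹ i l * (-2 * schouten (h 0) l j x))
        * ∑ l, (h 0 x)⁻¹ j l * (-2 * schouten (h 0) l i x) := by
    simp only [schoutenNormSq, Finset.sum_mul_sum]
    rw [Finset.mul_sum]
    refine Finset.sum_congr rfl fun i _ => ?_
    rw [Finset.sum_comm, Finset.mul_sum]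
    conv_rhs => rw [Finset.sum_comm]
    refine Finset.sum_congr rfl fun c _ => ?_
    rw [Finset.sum_comm, Finset.mul_sum]
    refine Finset.sum_congr rfl fun d _ => ?_
    rw [Finset.mul_sum]
    refine Finset.sum_congr rfl fun b _ => ?_
    rw [hinv b d, hPs i b]
    ring
  rw [e]
  refine (tendsto_finsetSum Finset.univ fun i _ => tendsto_finsetSum Finset.univ fun j _ =>
    (hS i j).mul (hS j i)).congr fun r => ?_
  rw [rDerivNormSq, Finset.sum_div]
  refine Finset.sum_congr rfl fun i _ => ?_
  rw [Finset.sum_div]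
  exact Finset.sum_congr rfl fun j _ => by field_simp

end IsRegularFamily

end Asymptotics

/-! ### Expansion of J for dr² + h_r and the boundary value of P_2(Q_2) -/

section BoundaryValue

variable {n : ℕ} {ε : ℝ} {U : Set (Fin n → ℝ)} {h : ℝ → (Fin n → ℝ) → Matrix (Fin n) (Fin n) ℝ}

namespace IsRegularFamily

variable (hh : IsRegularFamily ε U h)
include hh

theorem differentiableAt_meanCurv {p : Fin (n + 1) → ℝ} (hp : p ∈ openCollar ε U) :
    DifferentiableAt ℝ (meanCurv h) p := by
  have := fun i => hh.differentiableAt_shape hp i i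
  unfold meanCurv
  fun_prop

/-- The hypothesis traces with h_0, the geometry with h_r. The discrepancy is o(1) · O(r²), because
the tangential components are O(r²). -/
theorem tendsto_trace_einsteinDefect_div {x : Fin n → ℝ} (hx : x ∈ U)
    (hE : IsAsymptoticallyEinstein h x) :
    Tendsto (fun r => (einsteinDefect h r x 0 0 + ∑ i : Fin n, ∑ j : Fin n,
      (h r x)⁻¹ i j * einsteinDefect h r x i.succ j.succ) / r ^ 2) (𝓝[>] 0) (𝓝 0) := by
  have h1 : ∀ i j : Fin n, (fun r => ((h r x)⁻¹ i j - (h 0 x)⁻¹ i j)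
      * einsteinDefect h r x i.succ j.succ) =o[𝓝[>] 0] fun r : ℝ => r ^ 2 := fun i j => by
    have h0 : (fun r => (h r x)⁻¹ i j - (h 0 x)⁻¹ i j) =o[𝓝[>] 0] fun _ : ℝ => (1 : ℝ) := by
      rw [isLittleO_one_iff]
      simpa using (hh.tendsto_inv hx i j).sub_const ((h 0 x)⁻¹ i j)
    simpa using h0.mul_isBigO (hE.tangential i j)
  have h2 : (fun r => ∑ i : Fin n, ∑ j : Fin n, ((h r x)⁻¹ i j - (h 0 x)⁻¹ i j)
      * einsteinDefect h r x i.succ j.succ) =o[𝓝[>] 0] fun r : ℝ => r ^ 2 :=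
    IsLittleO.fun_sum fun i _ => IsLittleO.fun_sum fun j _ => h1 i j
  refine ((hE.normal.add (hE.trace.add h2)).tendsto_div_nhds_zero).congr fun r => ?_
  simp only [← Finset.sum_add_distrib]
  congr 2
  exact Finset.sum_congr rfl fun i _ => Finset.sum_congr rfl fun j _ => by ring

/-- The expansion `J + r^2 |P|^2 / 2 + o(r^2)` of `J` of the metric `dr^2 + h_r`. -/
theorem tendsto_J_cylMetric_sub_div (hn : 3 ≤ n) {x : Fin n → ℝ} (hx : x ∈ U)
    (hE : IsAsymptoticallyEinstein h x) :
    Tendsto (fun r => (J (cylMetric h) (Fin.cons r x) - J (h 0) x) / r ^ 2) (𝓝[>] 0)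
      (𝓝 (schoutenNormSq (h 0) x / 2)) := by
  obtain ⟨-, -, hL⟩ := hh.tendsto_rDeriv_div hn hx hE
  have hN := hh.tendsto_rDerivNormSq_div hn hx hE
  have hI := Ioo_mem_nhdsGT_zero hh.pos
  -- The dr dr equation, divided by r, is a formula for (L/r)', which is -|P|² r + o(r); integrating
  -- from the limit -J gives the quadratic coefficient.
  have hL2 : Tendsto (fun r => (meanCurv h (Fin.cons r x) / r - -J (h 0) x) / r ^ 2) (𝓝[>] 0)
      (𝓝 (-schoutenNormSq (h 0) x / 2)) := by
    refine tendsto_sub_div_sq hh.pos (f' := fun r => -((1 / 4) * rDerivNormSq h (Fin.cons r x)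
      + einsteinDefect h r x 0 0) / r) (fun r hr => ?_) hL ?_
    · have h0 := hr.1.ne'
      refine ((hasDerivAt_cons (hh.differentiableAt_meanCurv
        (cons_mem_openCollar hr hx))).fun_div (hasDerivAt_id' r) h0).congr_deriv ?_
      rw [hh.einsteinDefect_zero_zero hr hx]
      field_simp
      ring
    · have := ((hN.const_mul (1 / 4)).add hE.normal.tendsto_div_nhds_zero).neg
      have e : -(1 / 4 * (4 * schoutenNormSq (h 0) x) + 0) = -schoutenNormSq (h 0) x := by ring
      rw [e] at this
      refine this.congr' ?_
      filter_upwards [hI] with r hr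
      have := hr.1.ne'
      field_simp
  have hn0 : (n : ℝ) ≠ 0 := by
    have : n ≠ 0 := by omega
    exact_mod_cast this
  -- The trace divided by 2n is J̄ + L/r, so the expansion of L/r passes to J̄ with opposite sign.
  have := ((hh.tendsto_trace_einsteinDefect_div hx hE).div_const (2 * n)).sub hL2
  have e : 0 / (2 * (n : ℝ)) - -schoutenNormSq (h 0) x / 2 = schoutenNormSq (h 0) x / 2 := by ring
  rw [e] at this
  refine this.congr' ?_
  filter_upwards [hI] with r hr
  have hJ : J (cylMetric h) (Fin.cons r x) = scalarCurv (cylMetric h) (Fin.cons r x) / (2 * n) := by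
    rw [J, Fintype.card_fin]
    push_cast
    rw [add_sub_cancel_right]
  rw [hh.trace_einsteinDefect hr hx, hJ]
  have := hr.1.ne'
  field_simp
  ring

theorem tendsto_J_cylMetric (hn : 3 ≤ n) {x : Fin n → ℝ} (hx : x ∈ U)
    (hE : IsAsymptoticallyEinstein h x) :
    Tendsto (fun r => J (cylMetric h) (Fin.cons r x)) (𝓝[>] 0) (𝓝 (J (h 0) x)) := by
  have := ((hh.tendsto_J_cylMetric_sub_div hn hx hE).mul
    (tendsto_id_nhdsGT_zero.pow 2)).add_const (J (h 0) x)
  simp only [ne_eq, OfNat.ofNat_ne_zero, not_false_eq_true, zero_pow, mul_zero, zero_add] at this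
  refine this.congr' ?_
  filter_upwards [Ioo_mem_nhdsGT_zero hh.pos] with r hr
  have := hr.1.ne'
  field_simp
  ring

theorem pd_slice_eq {A : (Fin (n + 1) → ℝ) → ℝ} (hA : ContDiffOn ℝ (2 : ℕ) A (collar ε U)) {r : ℝ}
    (hr : r ∈ Ico 0 ε) {x : Fin n → ℝ} (hx : x ∈ U) (j : Fin n) :
    pd j (fun y => A (Fin.cons r y)) x = pdWithin (collar ε U) j.succ A (Fin.cons r x) :=
  (pdWithin_succ_collar hh.isOpen hr hx
    (differentiableOn_of_contDiffOn_two hA _ (cons_mem_collar hr hx)) j).symm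

theorem pd_pd_slice_eq {A : (Fin (n + 1) → ℝ) → ℝ} (hA : ContDiffOn ℝ (2 : ℕ) A (collar ε U))
    {r : ℝ} (hr : r ∈ Ico 0 ε) {x : Fin n → ℝ} (hx : x ∈ U) (i j : Fin n) :
    pd i (pd j fun y => A (Fin.cons r y)) x
      = pdWithin (collar ε U) i.succ (pdWithin (collar ε U) j.succ A) (Fin.cons r x) := by
  have h1 : ContDiffOn ℝ (1 : ℕ) (pdWithin (collar ε U) j.succ A) (collar ε U) :=
    contDiffOn_pdWithin hh.uniqueDiffOn hA
  rw [pdWithin_succ_collar hh.isOpen hr hx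
    (h1.differentiableOn (by norm_num) _ (cons_mem_collar hr hx))]
  refine pd_congr ?_
  filter_upwards [hh.isOpen.mem_nhds hx] with y hy using hh.pd_slice_eq hA hr hy j

theorem differentiableAt_slice {A : (Fin (n + 1) → ℝ) → ℝ}
    (hA : ContDiffOn ℝ (2 : ℕ) A (collar ε U)) {r : ℝ} (hr : r ∈ Ico 0 ε) {x : Fin n → ℝ}
    (hx : x ∈ U) : DifferentiableAt ℝ (fun y => A (Fin.cons r y)) x :=
  ((contDiffOn_cons_right hA hr).differentiableOn (by norm_num)).differentiableAt
    (hh.isOpen.mem_nhds hx)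

theorem differentiableAt_pd_slice {A : (Fin (n + 1) → ℝ) → ℝ}
    (hA : ContDiffOn ℝ (2 : ℕ) A (collar ε U)) {r : ℝ} (hr : r ∈ Ico 0 ε) {x : Fin n → ℝ}
    (hx : x ∈ U) (j : Fin n) : DifferentiableAt ℝ (pd j fun y => A (Fin.cons r y)) x := by
  have h1 : ContDiffOn ℝ (1 : ℕ) (pdWithin (collar ε U) j.succ A) (collar ε U) :=
    contDiffOn_pdWithin hh.uniqueDiffOn hA
  refine (((contDiffOn_cons_right h1 hr).differentiableOn (by norm_num)).differentiableAt
    (hh.isOpen.mem_nhds hx)).congr_of_eventuallyEq ?_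
  filter_upwards [hh.isOpen.mem_nhds hx] with y hy using hh.pd_slice_eq hA hr hy j

/-- The first two derivatives in `x` of a function with an `r^2 log r` term are continuous up to
the boundary. -/
theorem tendsto_pd_slice {F : (Fin (n + 1) → ℝ) → ℝ} (hF : IsLogSum (collar ε U) 2 2 F)
    {x : Fin n → ℝ} (hx : x ∈ U) :
    (∀ j, Tendsto (fun r => pd j (fun y => F (Fin.cons r y)) x) (𝓝[>] 0)
      (𝓝 (pd j (fun y => F (Fin.cons 0 y)) x))) ∧
    ∀ i j, Tendsto (fun r => pd i (pd j fun y => F (Fin.cons r y)) x) (𝓝[>] 0)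
      (𝓝 (pd i (pd j fun y => F (Fin.cons 0 y)) x)) := by
  obtain ⟨A, B, hA, hB, hAB⟩ := hF
  have l2 : Tendsto (fun r : ℝ => r ^ 2 * Real.log r) (𝓝[>] 0) (𝓝 0) :=
    tendsto_pow_succ_mul_log_zero 1
  -- The factor r² log r is constant along a slice, so tangential derivatives act on A and B
  -- separately.
  have e1 : ∀ r ∈ Ico 0 ε, ∀ y ∈ U, ∀ j, pd j (fun y => F (Fin.cons r y)) y
      = pd j (fun y => A (Fin.cons r y)) y
        + r ^ 2 * Real.log r * pd j (fun y => B (Fin.cons r y)) y := by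
    intro r hr y hy j
    rw [← pd_const_mul, ← pd_add (hh.differentiableAt_slice hA hr hy)
      ((hh.differentiableAt_slice hB hr hy).const_mul _)]
    refine pd_congr ?_
    filter_upwards [hh.isOpen.mem_nhds hy] with z hz
    simpa using hAB _ (cons_mem_collar hr hz)
  have e2 : ∀ r ∈ Ico 0 ε, ∀ i j, pd i (pd j fun y => F (Fin.cons r y)) x
      = pd i (pd j fun y => A (Fin.cons r y)) x
        + r ^ 2 * Real.log r * pd i (pd j fun y => B (Fin.cons r y)) x := by
    intro r hr i j
    rw [← pd_const_mul, ← pd_add (hh.differentiableAt_pd_slice hA hr hx j)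
      ((hh.differentiableAt_pd_slice hB hr hx j).const_mul _)]
    refine pd_congr ?_
    filter_upwards [hh.isOpen.mem_nhds hx] with z hz using e1 r hr z hz j
  have hI := Ioo_mem_nhdsGT_zero hh.pos
  have t1 : ∀ {A : (Fin (n + 1) → ℝ) → ℝ}, ContDiffOn ℝ (2 : ℕ) A (collar ε U) → ∀ j,
      Tendsto (fun r => pd j (fun y => A (Fin.cons r y)) x) (𝓝[>] 0)
        (𝓝 (pd j (fun y => A (Fin.cons 0 y)) x)) := by
    intro A hA j
    have h1 : ContDiffOn ℝ (1 : ℕ) (pdWithin (collar ε U) j.succ A) (collar ε U) :=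
      contDiffOn_pdWithin hh.uniqueDiffOn hA
    rw [hh.pd_slice_eq hA hh.zero_mem hx]
    refine (tendsto_cons_of_continuousOn hh.pos h1.continuousOn hx).congr' ?_
    filter_upwards [hI] with r hr using (hh.pd_slice_eq hA (Ioo_subset_Ico_self hr) hx j).symm
  have t2 : ∀ {A : (Fin (n + 1) → ℝ) → ℝ}, ContDiffOn ℝ (2 : ℕ) A (collar ε U) → ∀ i j,
      Tendsto (fun r => pd i (pd j fun y => A (Fin.cons r y)) x) (𝓝[>] 0)
        (𝓝 (pd i (pd j fun y => A (Fin.cons 0 y)) x)) := by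
    intro A hA i j
    have h1 : ContDiffOn ℝ (1 : ℕ) (pdWithin (collar ε U) j.succ A) (collar ε U) :=
      contDiffOn_pdWithin hh.uniqueDiffOn hA
    have h2 : ContDiffOn ℝ (0 : ℕ)
        (pdWithin (collar ε U) i.succ (pdWithin (collar ε U) j.succ A)) (collar ε U) :=
      contDiffOn_pdWithin hh.uniqueDiffOn h1
    rw [hh.pd_pd_slice_eq hA hh.zero_mem hx]
    refine (tendsto_cons_of_continuousOn hh.pos h2.continuousOn hx).congr' ?_
    filter_upwards [hI] with r hr using
      (hh.pd_pd_slice_eq hA (Ioo_subset_Ico_self hr) hx i j).symm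
  refine ⟨fun j => ?_, fun i j => ?_⟩
  · rw [e1 0 hh.zero_mem x hx]
    have := (t1 hA j).add (l2.mul (t1 hB j))
    simp only [ne_eq, OfNat.ofNat_ne_zero, not_false_eq_true, zero_pow, zero_mul] at this ⊢
    refine this.congr' ?_
    filter_upwards [hI] with r hr using (e1 r (Ioo_subset_Ico_self hr) x hx j).symm
  · rw [e2 0 hh.zero_mem]
    have := (t2 hA i j).add (l2.mul (t2 hB i j))
    simp only [ne_eq, OfNat.ofNat_ne_zero, not_false_eq_true, zero_pow, zero_mul] at this ⊢
    refine this.congr' ?_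
    filter_upwards [hI] with r hr using (e2 r (Ioo_subset_Ico_self hr) i j).symm

theorem tendsto_laplacian_slice {F : (Fin (n + 1) → ℝ) → ℝ} (hF : IsLogSum (collar ε U) 2 2 F)
    {x : Fin n → ℝ} (hx : x ∈ U) :
    Tendsto (fun r => laplacian (h r) (fun y => F (Fin.cons r y)) x) (𝓝[>] 0)
      (𝓝 (laplacian (h 0) (fun y => F (Fin.cons 0 y)) x)) := by
  obtain ⟨h1, h2⟩ := hh.tendsto_pd_slice hF hx
  simp only [laplacian, divergence]
  exact tendsto_finsetSum _ fun i _ => tendsto_finsetSum _ fun j _ =>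
    (hh.tendsto_inv hx i j).mul ((h2 i j).sub
      (tendsto_finsetSum _ fun k _ => (hh.tendsto_christoffel hx k i j).mul (h1 k)))

omit hh in
theorem laplacian_congr {ι : Type} [Fintype ι] [DecidableEq ι] {g : (ι → ℝ) → Matrix ι ι ℝ}
    {u v : (ι → ℝ) → ℝ} {x : ι → ℝ} (huv : u =ᶠ[𝓝 x] v) : laplacian g u x = laplacian g v x := by
  have h1 : ∀ i, pd i u =ᶠ[𝓝 x] pd i v := fun i => by
    filter_upwards [huv.eventuallyEq_nhds] with y hy using pd_congr hy
  simp only [laplacian, divergence]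
  refine Finset.sum_congr rfl fun i _ => Finset.sum_congr rfl fun j _ => ?_
  rw [pd_congr (h1 j)]
  congr 2
  exact Finset.sum_congr rfl fun k _ => by rw [(h1 k).eq_of_nhds]

/-- The boundary value of `Δ J` of the metric `dr^2 + h_r`. -/
theorem tendsto_laplacian_J_cylMetric (hn : 3 ≤ n)
    (hE : ∀ x ∈ U, IsAsymptoticallyEinstein h x) {x : Fin n → ℝ} (hx : x ∈ U) :
    Tendsto (fun r => laplacian (cylMetric h) (J (cylMetric h)) (Fin.cons r x)) (𝓝[>] 0)
      (𝓝 (schoutenNormSq (h 0) x + laplacian (h 0) (J (h 0)) x)) := by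
  obtain ⟨F, hF, hJF⟩ := hh.exists_isLogSum_J_cylMetric
  have hI := Ioo_mem_nhdsGT_zero hh.pos
  have hO := isOpen_openCollar (ε := ε) hh.isOpen
  -- The equality is needed on all of U, not just at x, because Δ_{h_0} differentiates the boundary
  -- values. This is why the Einstein condition is assumed at every point of U.
  have hF0 : ∀ y ∈ U, J (h 0) y = F (Fin.cons 0 y) := fun y hy => by
    have hFc : ContinuousOn F (collar ε U) :=
      ((hF.mono (j' := 0) le_rfl (by norm_num)).contDiffOn (k := 1) (by norm_num)).continuousOn
    refine tendsto_nhds_unique (hh.tendsto_J_cylMetric hn hy (hE y hy))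
      ((tendsto_cons_of_continuousOn hh.pos hFc hy).congr' ?_)
    filter_upwards [hI] with r hr using (hJF _ (cons_mem_openCollar hr hy)).symm
  have hlap := hh.tendsto_laplacian_slice hF hx
  rw [← laplacian_congr (u := J (h 0)) (by
    filter_upwards [hh.isOpen.mem_nhds hx] with y hy using hF0 y hy)] at hlap
  obtain ⟨A, B, hA, hB, hAB⟩ := hF
  have hJ2 : ContDiffOn ℝ (2 : ℕ) (J (cylMetric h)) (openCollar ε U) := by
    have hl : ContDiffOn ℝ (2 : ℕ) (fun p : Fin (n + 1) → ℝ => Real.log (p 0))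
        (openCollar ε U) :=
      (contDiff_apply ℝ ℝ (0 : Fin (n + 1))).contDiffOn.log fun p hp => hp.1.1.ne'
    have hr : ContDiffOn ℝ (2 : ℕ) (fun p : Fin (n + 1) → ℝ => p 0 ^ 2) (openCollar ε U) := by
      fun_prop
    refine ((hA.mono openCollar_subset).add
      ((hr.mul hl).mul (hB.mono openCollar_subset))).congr fun p hp => ?_
    rw [hJF p hp, hAB p (openCollar_subset hp)]
  have hJ1 : ContDiffOn ℝ (1 : ℕ) (pd 0 (J (cylMetric h))) (openCollar ε U) :=
    (contDiffOn_pdWithin (i := 0) hO.uniqueDiffOn hJ2).congr fun p hp =>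
      (pdWithin_of_mem_nhds (hO.mem_nhds hp)).symm
  set f : ℝ → ℝ := fun r => J (cylMetric h) (Fin.cons r x) with hf
  have d1 : ∀ r ∈ Ioo 0 ε, pd 0 (J (cylMetric h)) (Fin.cons r x) = deriv f r := fun r hr =>
    (hasDerivAt_cons ((hJ2.differentiableOn (by norm_num)).differentiableAt
      (hO.mem_nhds (cons_mem_openCollar hr hx)))).deriv.symm
  have d2 : ∀ r ∈ Ioo 0 ε, pd 0 (pd 0 (J (cylMetric h))) (Fin.cons r x) = deriv (deriv f) r := by
    intro r hr
    rw [← (hasDerivAt_cons ((hJ1.differentiableOn (by norm_num)).differentiableAt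
      (hO.mem_nhds (cons_mem_openCollar hr hx)))).deriv]
    refine EventuallyEq.deriv_eq ?_
    filter_upwards [Ioo_mem_nhds hr.1 hr.2] with s hs using d1 s hs
  -- Here γ = |P|², as the quadratic coefficient of J̄ is |P|²/2.
  obtain ⟨t1, t2⟩ := tendsto_derivs_of_log_expansion (f := f) hh.pos
    (contDiffOn_cons_left hA hx) (contDiffOn_cons_left hB hx) (fun r hr => by
      have := (hJF _ (cons_mem_openCollar hr hx)).trans
        (hAB _ (cons_mem_collar (Ioo_subset_Ico_self hr) hx))
      simpa using this) (hh.tendsto_J_cylMetric_sub_div hn hx (hE x hx))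
  -- Since L = (L/r) r → 0 and ∂_r J̄ → 0, the first-order term of the Laplacian disappears in the
  -- limit.
  have hL : Tendsto (fun r => meanCurv h (Fin.cons r x)) (𝓝[>] 0) (𝓝 0) := by
    have := (hh.tendsto_rDeriv_div hn hx (hE x hx)).2.2.mul tendsto_id_nhdsGT_zero
    rw [mul_zero] at this
    refine this.congr' ?_
    filter_upwards [hI] with r hr using div_mul_cancel₀ _ hr.1.ne'
  have := (t2.add (hL.mul t1)).add hlap
  rw [mul_zero, add_zero] at this
  refine this.congr' ?_
  filter_upwards [hI] with r hr
  rw [hh.laplacian_cylMetric hJ2 hr hx, d1 r hr, d2 r hr]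
  congr 1
  refine laplacian_congr ?_
  filter_upwards [hh.isOpen.mem_nhds hx] with y hy
  exact (hJF _ (cons_mem_openCollar hr hy)).symm

/-- The boundary value of `P_2 (Q_2)` of the metric `dr^2 + h_r`. -/
theorem hasBoundaryValue_P2_Q2 (hn : 3 ≤ n)
    (hE : ∀ x ∈ U, IsAsymptoticallyEinstein h x) {x : Fin n → ℝ} (hx : x ∈ U) :
    HasBoundaryValue (P2 (cylMetric h) (Q2 (cylMetric h))) x
      (schoutenNormSq (h 0) x + laplacian (h 0) (J (h 0)) x - (n - 1) / 2 * J (h 0) x ^ 2) := by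
  have hJ := hh.tendsto_J_cylMetric hn hx (hE x hx)
  refine ((hh.tendsto_laplacian_J_cylMetric hn hE hx).sub
    ((hJ.pow 2).const_mul (((n : ℝ) - 1) / 2))).congr fun r => ?_
  rw [P2, Q2, Fintype.card_fin]
  push_cast
  ring

end IsRegularFamily

end BoundaryValue

/-! ### The Paneitz operator on constants -/

section Constants

variable {ι : Type} [Fintype ι] [DecidableEq ι] (g : (ι → ℝ) → Matrix ι ι ℝ)

theorem laplacian_const (c : ℝ) : laplacian g (fun _ => c) = fun _ => 0 := by
  funext x
  have : ∀ i : ι, pd i (fun _ : ι → ℝ => c) = fun _ => 0 := fun i => funext fun y => pd_const c y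
  simp [laplacian, divergence, this]

theorem P4_one (x : ι → ℝ) :
    P4 g (fun _ => 1) x = ((Fintype.card ι : ℝ) / 2 - 2) * Q4 g x := by
  simp [P4, Q4, laplacian_const, divergence]

end Constants

/-! ### From the manifold to a chart -/

section Chart

set_option linter.unusedSectionVars false

variable {n : ℕ} {M : Type*} [TopologicalSpace M] [ChartedSpace (EuclideanSpace ℝ (Fin n)) M]
  [IsManifold (𝓡 n) ∞ M]

theorem isOpen_coordDomain (e : OpenPartialHomeomorph M (EuclideanSpace ℝ (Fin n))) :
    IsOpen (coordDomain e) :=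
  e.open_target.preimage (PiLp.continuous_toLp 2 _)

theorem coordMetric_symm (h : Metric n M)
    (e : OpenPartialHomeomorph M (EuclideanSpace ℝ (Fin n))) (x : Fin n → ℝ) (i j : Fin n) :
    coordMetric h e x i j = coordMetric h e x j i :=
  h.symm _ _ _

theorem mfderiv_symm_injective {e : OpenPartialHomeomorph M (EuclideanSpace ℝ (Fin n))}
    (he : e ∈ IsManifold.maximalAtlas (𝓡 n) ∞ M) {y : EuclideanSpace ℝ (Fin n)}
    (hy : y ∈ e.target) :
    Function.Injective (mfderiv (𝓡 n) (𝓡 n) e.symm y) := by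
  have hd : e.MDifferentiable (𝓡 n) (𝓡 n) :=
    ⟨(contMDiffOn_of_mem_maximalAtlas he).mdifferentiableOn (by simp),
      (contMDiffOn_symm_of_mem_maximalAtlas he).mdifferentiableOn (by simp)⟩
  exact hd.symm.mfderiv_injective hy

/-- A kernel vector v of the Gram matrix gives V = Σ v_i ∂_i with h(V, V) = 0. Positivity gives V =
0, and independence of the coordinate fields gives v = 0. -/
theorem coordMetric_det_ne_zero (h : Metric n M)
    {e : OpenPartialHomeomorph M (EuclideanSpace ℝ (Fin n))}
    (he : e ∈ IsManifold.maximalAtlas (𝓡 n) ∞ M) {x : Fin n → ℝ} (hx : x ∈ coordDomain e) :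
    (coordMetric h e x).det ≠ 0 := by
  intro hdet
  obtain ⟨v, hv0, hv⟩ := Matrix.exists_mulVec_eq_zero_iff.2 hdet
  set V : TangentSpace (𝓡 n) (e.symm (WithLp.toLp 2 x)) := ∑ i, v i • coordVector e x i with hV
  have hVV : h.inner (e.symm (WithLp.toLp 2 x)) V V = 0 := by
    have : ∀ i, h.inner (e.symm (WithLp.toLp 2 x)) (coordVector e x i) V = 0 := fun i => by
      have := congrFun hv i
      simp only [Matrix.mulVec, dotProduct, Pi.zero_apply] at this
      rw [hV, map_sum, ← this]
      exact Finset.sum_congr rfl fun j _ => by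
        rw [map_smul, smul_eq_mul, mul_comm]
        rfl
    conv_lhs => rw [hV]
    rw [h.symm, map_sum]
    refine Finset.sum_eq_zero fun i _ => ?_
    rw [map_smul, h.symm, this, smul_zero]
  have hV0 : V = 0 := by
    by_contra hne
    exact (h.pos _ V hne).ne' hVV
  let w : Fin n → TangentSpace (𝓡 n) (WithLp.toLp 2 x : EuclideanSpace ℝ (Fin n)) :=
    fun i => EuclideanSpace.single i (1 : ℝ)
  have hlin : mfderiv (𝓡 n) (𝓡 n) e.symm (WithLp.toLp 2 x) (∑ i, v i • w i) = V := by
    rw [hV, map_sum]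
    exact Finset.sum_congr rfl fun i _ => map_smul _ _ _
  have hw : ∑ i, v i • w i = 0 :=
    mfderiv_symm_injective he (y := WithLp.toLp 2 x) hx
      ((hlin.trans hV0).trans (map_zero _).symm)
  have hz : (∑ i, v i • EuclideanSpace.single i (1 : ℝ) : EuclideanSpace ℝ (Fin n)) = 0 := hw
  refine hv0 (funext fun j => ?_)
  have := congrArg (fun w : EuclideanSpace ℝ (Fin n) => w j) hz
  simpa [Pi.single_apply] using this

/-- As n ≥ 4, the factor r^(n-4) is absorbed into the log coefficient, and C^(n+1) implies C⁵. -/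
theorem IsPoincareEinstein.isRegularFamily (hn : 4 ≤ n) {h : Metric n M} {ε : ℝ}
    {H : ℝ → Metric n M} (hH : IsPoincareEinstein h ε H)
    {e : OpenPartialHomeomorph M (EuclideanSpace ℝ (Fin n))}
    (he : e ∈ IsManifold.maximalAtlas (𝓡 n) ∞ M) :
    IsRegularFamily ε (coordDomain e) fun s => coordMetric (H s) e where
  pos := hH.pos
  isOpen := isOpen_coordDomain e
  symm _ _ _ _ _ _ := coordMetric_symm _ _ _ _ _
  det_ne _ _ _ hx := coordMetric_det_ne_zero _ he hx
  isLogSum i j := by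
    obtain ⟨a, b, ha, hb, hab⟩ := hH.expansion e he
    have hφ : ContDiffOn ℝ ((n + 1 : ℕ) : ℕ∞) (fun p : Fin (n + 1) → ℝ => (p 0, Fin.tail p))
        (collar ε (coordDomain e)) :=
      ((contDiff_apply ℝ ℝ (0 : Fin (n + 1))).prodMk contDiff_tail).contDiffOn
    have hm : MapsTo (fun p : Fin (n + 1) → ℝ => (p 0, Fin.tail p))
        (collar ε (coordDomain e)) (Ico 0 ε ×ˢ coordDomain e) := fun _ hp => hp
    have : IsLogSum (collar ε (coordDomain e)) n (n + 1)
        fun p => coordMetric (H (p 0)) e (Fin.tail p) i j :=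
      ⟨_, _, (ha i j).comp hφ hm, (hb i j).comp hφ hm, fun p hp => hab _ hp.1 _ hp.2 i j⟩
    exact this.mono hn (by omega)

/-- Since n - 2 ≥ 2, the decay rates in r^(n-2) imply the same rates in r². -/
theorem IsPoincareEinstein.isAsymptoticallyEinstein (hn : 4 ≤ n) {h : Metric n M} {ε : ℝ}
    {H : ℝ → Metric n M} (hH : IsPoincareEinstein h ε H)
    {e : OpenPartialHomeomorph M (EuclideanSpace ℝ (Fin n))}
    (he : e ∈ IsManifold.maximalAtlas (𝓡 n) ∞ M) {x : Fin n → ℝ} (hx : x ∈ coordDomain e) :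
    IsAsymptoticallyEinstein (fun s => coordMetric (H s) e) x := by
  have hpow : (fun r : ℝ => r ^ (n - 2)) =O[𝓝[>] 0] fun r : ℝ => r ^ 2 :=
    IsBigO.of_bound 1 (by
      filter_upwards [Ioo_mem_nhdsGT_zero one_pos] with r hr
      rw [one_mul, norm_pow, norm_pow, Real.norm_of_nonneg hr.1.le]
      exact pow_le_pow_of_le_one hr.1.le hr.2.le (by omega))
  refine ⟨fun i j => (hH.einstein e he x hx i.succ j.succ).trans hpow,
    (hH.normal e he x hx 0).trans_isBigO hpow, ?_⟩
  have := (hH.trace e he x hx).trans_isBigO hpow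
  rwa [← hH.initial] at this

end Chart

end QCurv

/-! ### The identity for Q_4 -/

theorem mainTheorem4 (n : ℕ) (hn : 4 ≤ n) (hn_even : Even n)
    (M : Type*) [TopologicalSpace M] [ChartedSpace (EuclideanSpace ℝ (Fin n)) M]
    [IsManifold (𝓡 n) ∞ M]
    (h : QCurv.Metric n M) (ε : ℝ) (H : ℝ → QCurv.Metric n M)
    (hH : QCurv.IsPoincareEinstein h ε H)
    (e : OpenPartialHomeomorph M (EuclideanSpace ℝ (Fin n)))
    (he : e ∈ IsManifold.maximalAtlas (𝓡 n) ∞ M)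
    (x : Fin n → ℝ) (hx : x ∈ QCurv.coordDomain e) :
    QCurv.P4 (QCurv.coordMetric h e) (fun _ => 1) x
        = ((n : ℝ) / 2 - 2) * QCurv.Q4 (QCurv.coordMetric h e) x ∧
    ∃ c : ℝ,
      QCurv.HasBoundaryValue
        (QCurv.P2 (QCurv.barMetric H e) (QCurv.Q2 (QCurv.barMetric H e))) x c ∧
      QCurv.Q4 (QCurv.coordMetric h e) x
        = QCurv.P2 (QCurv.coordMetric h e) (QCurv.Q2 (QCurv.coordMetric h e)) x - 2 * c := by
  refine ⟨by simpa using QCurv.P4_one (QCurv.coordMetric h e) x, _,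
    (hH.isRegularFamily hn he).hasBoundaryValue_P2_Q2 (by omega)
      (fun y hy => hH.isAsymptoticallyEinstein hn he hy) hx, ?_⟩
  -- With c = |P|² + ΔJ - (n-1)/2 J², the J² coefficients add up as -(n/2 - 1) + (n - 1) = n/2, and
  -- ΔJ - 2ΔJ = -ΔJ.
  simp only [hH.initial, QCurv.Q4, QCurv.P2, QCurv.Q2, Fintype.card_fin]
  ring
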